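/- **Setting.** A weight on $\mathbb R$ is a function $w:\mathbb R\to[0,\infty)$ such that $\int_{\mathbb R} x^k w(x)\,dx$ is finite for every integer $k\ge 0$. Let $w_{1,1},\dots,w_{1,p}$ and $w_{2,1},\dots,w_{2,q}$ be weights on $\mathbb R$, and let $\vec n=(n_1,\dots,n_p)$, $\vec m=(m_1,\dots,m_q)$ be vectors of non-negative integers with $|\vec n|:=\sum_k n_k=\sum_l m_l=:|\vec m|$. Assume that $x^jw_{1,k}\in L^2(\mathbb R)$ for $0\le j\le n_k-1$, $1\le k\le p$, and that $x^jw_{2,l}\in L^2(\mathbb R)$ for $0\le j\le m_l-1$, $1\le l\le q$. Put $$F_{\vec n}=\Big\{\sum_{k=1}^pA_kw_{1,k}:\ A_k\in\mathbb R[x],\ \deg A_k\le n_k-1\Big\},\qquad G_{\vec m}=\Big\{\sum_{l=1}^qB_lw_{2,l}:\ B_l\in\mathbb R[x],\ \deg B_l\le m_l-1\Big\},$$ and assume that, as subspaces of the real Hilbert space $L^2(\mathbb R)$, both have dimension $|\vec n|$ and $F_{\vec n}\cap G_{\vec m}^{\perp}=\{0\}$. Consider the following Riemann–Hilbert problem for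 a $(p+q)\times(p+q)$ matrix-valued function $Y$ on $\mathbb C\setminus\mathbb R$: 1. $Y$ is analytic on $\mathbb C\setminus\mathbb R$; 2. for every $x\in\mathbb R$ the limits $Y_{+}(x)$ and $Y_-(x)$ of $Y(z)$ as $z\to x$ from the upper and from the lower half plane exist, and $$Y_+(x)=Y_-(x)\begin{bmatrix}I_p&W(x)\\0&I_q\end{bmatrix},\qquad W(x)=\big(w_{1,k}(x)\,w_{2,l}(x)\big)_{k,l};$$ 3. $Y(z)=\big(I_{p+q}+O(1/z)\big)\,\mathrm{diag}\big(z^{n_1},\dots,z^{n_p},z^{-m_1},\dots,z^{-m_q}\big)$ as $z\to\infty$, $z\in\mathbb C\setminus\mathbb R$. **Theorem.** There exist biorthogonal bases $\phi_1,\dots,\phi_{|\vec n|}$ of $F_{\vec n}$ and $\psi_1,\dots,\psi_{|\vec n|}$ of $G_{\vec m}$, that is, bases with $\int_{\mathbb R}\phi_j(x)\psi_k(x)\,dx=\delta_{j,k}$. For any such bases, let $K(x,y)=\sum_{j=1}^{|\vec n|}\phi_j(x)\psi_j(y)$. If $Y$ is a solution of the Riemann–Hilbert problem, then $Y_+(y)$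 is invertible for every $y\in\mathbb R$, and for all real $x\ne y$ $$K(x,y)=\frac{1}{2\pi i(x-y)}\begin{bmatrix}0&\cdots&0&w_{2,1}(y)&\cdots&w_{2,q}(y)\end{bmatrix}Y_+^{-1}(y)\,Y_+(x)\begin{bmatrix}w_{1,1}(x)&\cdots&w_{1,p}(x)&0&\cdots&0\end{bmatrix}^t .$$ -/

import Mathlib

open MeasureTheory Filter Topology Polynomial

namespace MixedMOP

/-- A weight on the real line: a nonnegative function all of whose moments are finite. -/
def IsWeight (w : ℝ → ℝ) : Prop :=
  (∀ x, 0 ≤ w x) ∧ ∀ k : ℕ, Integrable (fun x : ℝ => x ^ k * w x) volume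

/-- The linear form `∑ₖ Aₖ(x) wₖ(x)` with polynomial coefficients `Aₖ`. -/
noncomputable def linForm {r : ℕ} (w : Fin r → ℝ → ℝ) (A : Fin r → ℝ[X]) : ℝ → ℝ :=
  fun x => ∑ k, (A k).eval x * w k x

/-- The space of all functions `∑ₖ Aₖ wₖ` with polynomials `Aₖ` of degree at most `nₖ - 1`
(so `Aₖ = 0` if `nₖ = 0`). -/
noncomputable def formSpace {r : ℕ} (w : Fin r → ℝ → ℝ) (n : Fin r → ℕ) :
    Submodule ℝ (ℝ → ℝ) where
  carrier := {f | ∃ A : Fin r → ℝ[X], (∀ k, (A k).degree < (n k : WithBot ℕ)) ∧ f = linForm w A}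
  zero_mem' := by
    refine ⟨fun _ => 0, fun k => ?_, ?_⟩
    · simp only [degree_zero]
      exact WithBot.bot_lt_coe _
    · funext x
      simp [linForm]
  add_mem' := by
    rintro f g ⟨A, hA, rfl⟩ ⟨B, hB, rfl⟩
    refine ⟨fun k => A k + B k, fun k => ?_, ?_⟩
    · exact lt_of_le_of_lt (degree_add_le _ _) (max_lt (hA k) (hB k))
    · funext x
      simp [linForm, add_mul, Finset.sum_add_distrib]
  smul_mem' := by
    rintro c f ⟨A, hA, rfl⟩
    refine ⟨fun k => c • A k, fun k => ?_, ?_⟩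
    · exact lt_of_le_of_lt (degree_smul_le _ _) (hA k)
    · funext x
      simp [linForm, Finset.mul_sum, mul_assoc]

/-- The subspace of the real Hilbert space `L²(ℝ)` formed by the classes of the functions in
`formSpace w n`. -/
noncomputable def formSpaceL2 {r : ℕ} (w : Fin r → ℝ → ℝ) (n : Fin r → ℕ) :
    Submodule ℝ (Lp ℝ 2 (volume : Measure ℝ)) where
  carrier := {g | ∃ f ∈ formSpace w n, (g : ℝ → ℝ) =ᵐ[volume] f}
  zero_mem' := ⟨0, (formSpace w n).zero_mem, Lp.coeFn_zero ℝ 2 volume⟩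
  add_mem' := by
    rintro g₁ g₂ ⟨f₁, h₁, e₁⟩ ⟨f₂, h₂, e₂⟩
    exact ⟨f₁ + f₂, (formSpace w n).add_mem h₁ h₂, (Lp.coeFn_add g₁ g₂).trans (e₁.add e₂)⟩
  smul_mem' := by
    rintro c g ⟨f, h, e⟩
    exact ⟨c • f, (formSpace w n).smul_mem c h, (Lp.coeFn_smul c g).trans (e.const_smul c)⟩

/-- `φ` and `ψ` are biorthogonal bases of the function spaces `F` and `G`. -/
structure IsBiorthogonalBases {N : ℕ} (F G : Submodule ℝ (ℝ → ℝ)) (φ ψ : Fin N → ℝ → ℝ) :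
    Prop where
  linearIndependent_left : LinearIndependent ℝ φ
  span_left : Submodule.span ℝ (Set.range φ) = F
  linearIndependent_right : LinearIndependent ℝ ψ
  span_right : Submodule.span ℝ (Set.range ψ) = G
  biorthogonal : ∀ j k, ∫ x : ℝ, φ j x * ψ k x = if j = k then 1 else 0

/-- The kernel `K(x, y) = ∑ⱼ φⱼ(x) ψⱼ(y)`. -/
def kernel {N : ℕ} (φ ψ : Fin N → ℝ → ℝ) (x y : ℝ) : ℝ :=
  ∑ j, φ j x * ψ j y

/-- The `p × q` matrix `W(x) = w₁(x)ᵗ w₂(x)`. -/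
def weightMatrix {p q : ℕ} (w₁ : Fin p → ℝ → ℝ) (w₂ : Fin q → ℝ → ℝ) (x : ℝ) :
    Matrix (Fin p) (Fin q) ℂ :=
  Matrix.of fun k l => (w₁ k x : ℂ) * (w₂ l x : ℂ)

/-- The jump matrix with blocks `I_p`, `W(x)`, `0`, `I_q`. -/
def jumpMatrix {p q : ℕ} (w₁ : Fin p → ℝ → ℝ) (w₂ : Fin q → ℝ → ℝ) (x : ℝ) :
    Matrix (Fin p ⊕ Fin q) (Fin p ⊕ Fin q) ℂ :=
  Matrix.fromBlocks 1 (weightMatrix w₁ w₂ x) 0 1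

/-- The diagonal matrix `diag(z^{n₁}, …, z^{n_p}, z^{-m₁}, …, z^{-m_q})`. -/
noncomputable def asymptoticFactor {p q : ℕ} (n : Fin p → ℕ) (m : Fin q → ℕ) (z : ℂ) :
    Matrix (Fin p ⊕ Fin q) (Fin p ⊕ Fin q) ℂ :=
  Matrix.diagonal (Sum.elim (fun k => z ^ n k) (fun l => z ^ (-(m l : ℤ))))

/-- `Y` solves the Riemann–Hilbert problem, and `Yplus`, `Yminus` are its boundary values on `ℝ`
from the upper and from the lower half plane. The values of `Y` on `ℝ` itself are irrelevant. -/
structure IsRHSolution {p q : ℕ} (w₁ : Fin p → ℝ → ℝ) (w₂ : Fin q → ℝ → ℝ)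
    (n : Fin p → ℕ) (m : Fin q → ℕ)
    (Y : ℂ → Matrix (Fin p ⊕ Fin q) (Fin p ⊕ Fin q) ℂ)
    (Yplus Yminus : ℝ → Matrix (Fin p ⊕ Fin q) (Fin p ⊕ Fin q) ℂ) : Prop where
  analytic : ∀ i j, DifferentiableOn ℂ (fun z => Y z i j) {z | z.im ≠ 0}
  tendsto_plus : ∀ x : ℝ, Tendsto Y (𝓝[{z | 0 < z.im}] (x : ℂ)) (𝓝 (Yplus x))
  tendsto_minus : ∀ x : ℝ, Tendsto Y (𝓝[{z | z.im < 0}] (x : ℂ)) (𝓝 (Yminus x))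
  jump : ∀ x : ℝ, Yplus x = Yminus x * jumpMatrix w₁ w₂ x
  asymptotics : ∃ E : ℂ → Matrix (Fin p ⊕ Fin q) (Fin p ⊕ Fin q) ℂ,
    (∀ i j, (fun z => E z i j)
      =O[Bornology.cobounded ℂ ⊓ 𝓟 {z | z.im ≠ 0}] fun z => (1 : ℂ) / z) ∧
    ∀ z : ℂ, z.im ≠ 0 → Y z = (1 + E z) * asymptoticFactor n m z

/-- The vector `(w₁(x), 0)` of length `p + q`. -/
def leftVec {p : ℕ} (q : ℕ) (w₁ : Fin p → ℝ → ℝ) (x : ℝ) : Fin p ⊕ Fin q → ℂ :=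
  Sum.elim (fun k => (w₁ k x : ℂ)) (fun _ => 0)

/-- The vector `(0, w₂(y))` of length `p + q`. -/
def rightVec (p : ℕ) {q : ℕ} (w₂ : Fin q → ℝ → ℝ) (y : ℝ) : Fin p ⊕ Fin q → ℂ :=
  Sum.elim (fun _ => 0) (fun l => (w₂ l y : ℂ))

end MixedMOP

/-! The existence of biorthogonal bases is finite-dimensional duality: the integral pairing of the
two form spaces is nondegenerate and the dimensions agree, so a basis of one has a dual basis in the
other (`exists_isBiorthogonalBases`).

For the kernel formula, `det Y` has no jump and tends to `1`, so it is identically `1`, and the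
adjugate of `Y` serves as its inverse. The first `p` columns of `Y` and the last `q` rows of `Y⁻¹`
also have no jump, hence are polynomial. The lower left block of `Y⁻¹(y) Y(z)` is therefore
polynomial in both variables and vanishes at `y = z`. Dividing its entries by `z - y` and pairing
with the weights `w₂` gives, for each column `k`, a function of `y` in the span of the `ψⱼ`.

That function reproduces (`integral_dividedDifference_mul_linForm`): for a form `∑ⱼ Pⱼ w₁ⱼ`, the sum
`∑ⱼ Pⱼ(ζ) (Y⁻¹(ζ) Y(z))ⱼₖ` is `O(1/ζ)`, equals `Pₖ(z)` at `ζ = z`, and its jump divided by `y - z`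
is the integrand. Cauchy's formula gives `2πi Pₖ(z)`. Testing against `φⱼ` identifies the
coefficient of `ψⱼ` for `z` in the upper half plane, continuity carries this to real `x`, and
summing over `k` against `w₁ₖ(x)` produces the kernel. -/

namespace MixedMOP

/-! ### Cauchy's theorem and formula in the upper half plane -/

/-- `f` is holomorphic in the upper half plane with limit `fp x` at every real `x`. -/
structure UpperBoundaryValues (f : ℂ → ℂ) (fp : ℝ → ℂ) : Prop where
  differentiableOn : DifferentiableOn ℂ f {z | 0 < z.im}
  tendsto : ∀ x : ℝ, Tendsto f (𝓝[{z | 0 < z.im}] (x : ℂ)) (𝓝 (fp x))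

/-- The filter of complex numbers tending to infinity in the upper half plane. -/
noncomputable abbrev upperInfty : Filter ℂ := Bornology.cobounded ℂ ⊓ 𝓟 {z : ℂ | 0 < z.im}

theorem exists_bound_of_isBigO_upperInfty {f : ℂ → ℂ} {k : ℕ}
    (h : f =O[upperInfty] fun z => (1 / z) ^ k) :
    ∃ C R : ℝ, 0 ≤ C ∧ 0 < R ∧ ∀ z : ℂ, 0 < z.im → R ≤ ‖z‖ → ‖f z‖ ≤ C / ‖z‖ ^ k := by
  obtain ⟨C, hC⟩ := h.bound
  rw [eventually_inf_principal, Filter.hasBasis_cobounded_norm.eventually_iff] at hC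
  obtain ⟨R, -, hR⟩ := hC
  refine ⟨max C 0, max R 1, le_max_right _ _, by positivity, fun z hz hRz => ?_⟩
  refine (hR ((le_max_left _ _).trans hRz) hz).trans ?_
  rw [norm_pow, norm_div, norm_one, one_div, div_eq_mul_inv, inv_pow]
  gcongr
  exact le_max_left _ _

theorem ofReal_mem_closure_upper (x : ℝ) : (x : ℂ) ∈ closure {z : ℂ | 0 < z.im} := by
  rw [Complex.closure_setOfPred_lt_im]
  simp

theorem nhdsWithin_upper_neBot (x : ℝ) : (𝓝[{z : ℂ | 0 < z.im}] (x : ℂ)).NeBot :=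
  mem_closure_iff_nhdsWithin_neBot.1 (ofReal_mem_closure_upper x)

namespace UpperBoundaryValues

variable {f g : ℂ → ℂ} {fp gp : ℝ → ℂ}

/-- The limits at real points are taken through the whole half plane, not along vertical lines, so
extension by limits is automatically continuous on the closed half plane. -/
theorem exists_extension (h : UpperBoundaryValues f fp) :
    ∃ F : ℂ → ℂ, ContinuousOn F {z | 0 ≤ z.im} ∧ (∀ z : ℂ, 0 < z.im → F z = f z) ∧
      ∀ x : ℝ, F x = fp x := by
  refine ⟨extendFrom {z : ℂ | 0 < z.im} f, ?_, ?_, ?_⟩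
  · refine continuousOn_extendFrom ?_ ?_
    · rw [Complex.closure_setOfPred_lt_im]
    · intro z hz
      rcases (show (0 : ℝ) ≤ z.im from hz).lt_or_eq with hz | hz
      · exact ⟨f z, (h.differentiableOn.continuousOn z hz)⟩
      · refine ⟨fp z.re, ?_⟩
        have : ((z.re : ℝ) : ℂ) = z := by
          apply Complex.ext <;> simp [hz.symm]
        simpa [this] using h.tendsto z.re
  · intro z hz
    exact extendFrom_extends h.differentiableOn.continuousOn z hz
  · intro x
    exact extendFrom_eq (ofReal_mem_closure_upper x) (h.tendsto x)

theorem continuous_boundary (h : UpperBoundaryValues f fp) : Continuous fp := by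
  obtain ⟨F, hF, -, hFp⟩ := h.exists_extension
  have : fp = fun x : ℝ => F x := funext fun x => (hFp x).symm
  rw [this]
  exact hF.comp_continuous Complex.continuous_ofReal (by simp)

theorem boundary_bound (h : UpperBoundaryValues f fp) {C R : ℝ} {k : ℕ} (hR : 0 < R)
    (hb : ∀ z : ℂ, 0 < z.im → R ≤ ‖z‖ → ‖f z‖ ≤ C / ‖z‖ ^ k) (x : ℝ) (hx : R < |x|) :
    ‖fp x‖ ≤ C / |x| ^ k := by
  have := nhdsWithin_upper_neBot x
  have hx0 : (x : ℂ) ≠ 0 := by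
    rintro h0
    simp only [Complex.ofReal_eq_zero] at h0
    simp [h0] at hx
    linarith
  have hlim : Tendsto (fun z : ℂ => C / ‖z‖ ^ k) (𝓝[{z : ℂ | 0 < z.im}] (x : ℂ))
      (𝓝 (C / |x| ^ k)) := by
    have : ContinuousAt (fun z : ℂ => C / ‖z‖ ^ k) (x : ℂ) := by
      refine continuousAt_const.div (by fun_prop) (pow_ne_zero _ (norm_ne_zero_iff.2 hx0))
    simpa [Complex.norm_real] using this.tendsto.mono_left nhdsWithin_le_nhds
  refine le_of_tendsto_of_tendsto (h.tendsto x).norm hlim ?_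
  have h1 : ∀ᶠ z : ℂ in 𝓝[{z : ℂ | 0 < z.im}] (x : ℂ), R < ‖z‖ := by
    refine nhdsWithin_le_nhds (continuous_norm.continuousAt.eventually (lt_mem_nhds ?_))
    simpa using hx
  filter_upwards [h1, self_mem_nhdsWithin] with z hz hz'
  exact hb z hz' hz.le

theorem integrable_boundary (h : UpperBoundaryValues f fp)
    (hO : f =O[upperInfty] fun z => (1 / z) ^ 2) : Integrable fp := by
  obtain ⟨C, R, hC, hR, hb⟩ := exists_bound_of_isBigO_upperInfty hO
  -- The factor `2` comes from `1 + x² ≤ 2x²` for `|x| > 1`.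
  have key : ∀ x : ℝ, max R 1 < |x| → ‖fp x‖ ≤ (2 * C) * ‖(1 + x ^ 2)⁻¹‖ := by
    intro x hx
    have h1 := h.boundary_bound hR hb x ((le_max_left _ _).trans_lt hx)
    have h2 : 1 < |x| := (le_max_right _ _).trans_lt hx
    have h3 : 1 < x ^ 2 := by rw [← sq_abs]; nlinarith
    refine h1.trans ?_
    rw [sq_abs, Real.norm_of_nonneg (by positivity), ← div_eq_mul_inv,
      div_le_div_iff₀ (by positivity) (by positivity)]
    nlinarith
  refine h.continuous_boundary.locallyIntegrable.integrable_of_isBigO_atBot_atTop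
    (g := fun x : ℝ => (1 + x ^ 2)⁻¹) (g' := fun x : ℝ => (1 + x ^ 2)⁻¹) ?_
    (integrable_inv_one_add_sq.integrableAtFilter _) ?_
    (integrable_inv_one_add_sq.integrableAtFilter _)
  · refine Asymptotics.IsBigO.of_bound (2 * C) ?_
    filter_upwards [eventually_lt_atBot (-(max R 1))] with x hx
    exact key x (by rw [lt_abs]; right; linarith)
  · refine Asymptotics.IsBigO.of_bound (2 * C) ?_
    filter_upwards [eventually_gt_atTop (max R 1)] with x hx
    exact key x (by rw [lt_abs]; left; linarith)

/-- Integrate around the rectangle `[-T, T] × [0, T]`. The three sides off the axis have total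
length `4T`, and the function is at most `C / T²` on them. -/
theorem norm_intervalIntegral_le (h : UpperBoundaryValues f fp) {C R : ℝ} (hR : 0 < R)
    (hC : 0 ≤ C) (hb : ∀ z : ℂ, 0 < z.im → R ≤ ‖z‖ → ‖f z‖ ≤ C / ‖z‖ ^ 2) {T : ℝ} (hT : R < T) :
    ‖∫ x in (-T)..T, fp x‖ ≤ 4 * C / T := by
  have hT0 : 0 < T := hR.trans hT
  obtain ⟨F, hF, hFf, hFp⟩ := h.exists_extension
  have hFb : ∀ z : ℂ, 0 < z.im → T ≤ ‖z‖ → ‖F z‖ ≤ C / T ^ 2 := by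
    intro z hz hzT
    rw [hFf z hz]
    refine (hb z hz (hT.le.trans hzT)).trans ?_
    gcongr
  have hrect := Complex.integral_boundary_rect_eq_zero_of_continuousOn_of_differentiableOn F
    (⟨-T, 0⟩ : ℂ) (⟨T, T⟩ : ℂ) ?_ ?_
  · simp only [Complex.ofReal_zero, zero_mul, add_zero, hFp] at hrect
    have e1 : ‖∫ x : ℝ in (-T)..T, F (x + T * Complex.I)‖ ≤ C / T ^ 2 * |T - -T| := by
      refine intervalIntegral.norm_integral_le_of_norm_le_const fun x _ => hFb _ (by simpa) ?_
      simpa [abs_of_pos hT0] using Complex.abs_im_le_norm (x + T * Complex.I)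
    have e2 : ‖∫ y : ℝ in (0 : ℝ)..T, F (T + y * Complex.I)‖ ≤ C / T ^ 2 * |T - 0| := by
      refine intervalIntegral.norm_integral_le_of_norm_le_const fun y hy => hFb _ ?_ ?_
      · rw [Set.uIoc_of_le hT0.le] at hy
        simpa using hy.1
      · simpa [abs_of_pos hT0] using Complex.abs_re_le_norm (T + y * Complex.I)
    have e3 : ‖∫ y : ℝ in (0 : ℝ)..T, F ((-T : ℝ) + y * Complex.I)‖ ≤ C / T ^ 2 * |T - 0| := by
      refine intervalIntegral.norm_integral_le_of_norm_le_const fun y hy => hFb _ ?_ ?_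
      · rw [Set.uIoc_of_le hT0.le] at hy
        simpa using hy.1
      · simpa [abs_of_pos hT0] using Complex.abs_re_le_norm ((-T : ℝ) + y * Complex.I)
    have hsum : (∫ x in (-T)..T, fp x) = (∫ x : ℝ in (-T)..T, F (x + T * Complex.I)) -
        Complex.I • (∫ y : ℝ in (0 : ℝ)..T, F (T + y * Complex.I)) +
        Complex.I • (∫ y : ℝ in (0 : ℝ)..T, F ((-T : ℝ) + y * Complex.I)) := by
      linear_combination hrect
    rw [hsum]
    refine (norm_add_le _ _).trans ((add_le_add_left (norm_sub_le _ _) _).trans ?_)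
    rw [norm_smul, norm_smul, Complex.norm_I, one_mul, one_mul]
    have h4 : C / T ^ 2 * |T - -T| + C / T ^ 2 * |T - 0| + C / T ^ 2 * |T - 0| = 4 * C / T := by
      rw [abs_of_pos (by linarith : (0 : ℝ) < T - -T), abs_of_pos (by linarith : (0 : ℝ) < T - 0)]
      field_simp
      ring
    linarith
  · refine hF.mono ?_
    intro z hz
    have := hz.2
    simp only [Set.mem_preimage, Set.uIcc_of_le hT0.le] at this
    exact this.1
  · have hsub : (Set.Ioo (min (-T) T) (max (-T) T) ×ℂ Set.Ioo (min 0 T) (max 0 T)) ⊆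
        {z : ℂ | 0 < z.im} := by
      intro z hz
      have := hz.2
      simp only [Set.mem_preimage, min_eq_left hT0.le] at this
      exact this.1
    exact (h.differentiableOn.congr fun z hz => hFf z hz).mono hsub

/-- Cauchy's theorem for the upper half plane. -/
theorem integral_boundary_eq_zero (h : UpperBoundaryValues f fp)
    (hO : f =O[upperInfty] fun z => (1 / z) ^ 2) : ∫ x, fp x = 0 := by
  obtain ⟨C, R, hC, hR, hb⟩ := exists_bound_of_isBigO_upperInfty hO
  have h1 : Tendsto (fun T : ℝ => ∫ x in (-T)..T, fp x) atTop (𝓝 (∫ x, fp x)) :=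
    intervalIntegral_tendsto_integral (h.integrable_boundary hO) tendsto_neg_atTop_atBot tendsto_id
  have h2 : Tendsto (fun T : ℝ => ∫ x in (-T)..T, fp x) atTop (𝓝 0) := by
    refine squeeze_zero_norm' (a := fun T : ℝ => 4 * C / T) ?_
      (tendsto_const_nhds.div_atTop tendsto_id)
    filter_upwards [eventually_gt_atTop R] with T hT
    exact h.norm_intervalIntegral_le hR hC hb hT
  exact tendsto_nhds_unique h1 h2

theorem sub (h : UpperBoundaryValues f fp) (h' : UpperBoundaryValues g gp) :
    UpperBoundaryValues (fun z => f z - g z) fun x => fp x - gp x :=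
  ⟨h.differentiableOn.sub h'.differentiableOn, fun x => (h.tendsto x).sub (h'.tendsto x)⟩

theorem mul (h : UpperBoundaryValues f fp) (h' : UpperBoundaryValues g gp) :
    UpperBoundaryValues (fun z => f z * g z) fun x => fp x * gp x :=
  ⟨h.differentiableOn.mul h'.differentiableOn, fun x => (h.tendsto x).mul (h'.tendsto x)⟩

theorem of_differentiableAt (h : ∀ z : ℂ, 0 ≤ z.im → DifferentiableAt ℂ f z) :
    UpperBoundaryValues f fun x => f x :=
  ⟨fun z hz => (h z (le_of_lt hz)).differentiableWithinAt, fun x =>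
    (h x (by simp)).continuousAt.tendsto.mono_left nhdsWithin_le_nhds⟩

theorem dslope (h : UpperBoundaryValues f fp) {z₀ : ℂ} (hz₀ : 0 < z₀.im) :
    UpperBoundaryValues (dslope f z₀) fun x => (fp x - f z₀) / (x - z₀) := by
  refine ⟨(Complex.differentiableOn_dslope ?_).2 h.differentiableOn, fun x => ?_⟩
  · exact (isOpen_lt continuous_const Complex.continuous_im).mem_nhds hz₀
  · have hne : (x : ℂ) ≠ z₀ := by
      rintro rfl
      simp at hz₀
    have hlim : Tendsto (fun z : ℂ => (f z - f z₀) / (z - z₀))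
        (𝓝[{z : ℂ | 0 < z.im}] (x : ℂ)) (𝓝 ((fp x - f z₀) / (x - z₀))) :=
      ((h.tendsto x).sub_const _).div
        (((continuous_id.sub continuous_const).continuousAt.tendsto).mono_left nhdsWithin_le_nhds)
        (sub_ne_zero.2 hne)
    refine hlim.congr' ?_
    filter_upwards [nhdsWithin_le_nhds (isOpen_ne.mem_nhds hne)] with z hz
    rw [dslope_of_ne _ hz, slope_def_field]

end UpperBoundaryValues

theorem isBigO_inv_sub (z₀ : ℂ) :
    (fun z : ℂ => (z - z₀)⁻¹) =O[Bornology.cobounded ℂ] fun z => 1 / z := by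
  refine Asymptotics.IsBigO.of_bound 2 ?_
  filter_upwards [Filter.hasBasis_cobounded_norm.mem_of_mem (i := 2 * ‖z₀‖ + 1) trivial] with z hz
  have hz : 2 * ‖z₀‖ + 1 ≤ ‖z‖ := hz
  have h1 : ‖z‖ ≤ ‖z - z₀‖ + ‖z₀‖ := by simpa using norm_add_le (z - z₀) z₀
  have h0 : 0 ≤ ‖z₀‖ := norm_nonneg _
  have h3 : 0 < ‖z‖ := by linarith
  have h2 : 0 < ‖z - z₀‖ := by linarith
  rw [norm_inv, norm_div, norm_one, inv_eq_one_div, mul_one_div, div_le_div_iff₀ h2 h3]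
  linarith

/-- This supplies the explicit constant in Cauchy's formula: the denominator is `(x - Re z₀)² + (Im
z₀)²`, so the integral is a rescaled arctangent integral. -/
theorem integral_inv_sub_mul_sub_conj {z₀ : ℂ} (hz₀ : 0 < z₀.im) :
    ∫ x : ℝ, (((x : ℂ) - (starRingEnd ℂ) z₀) * ((x : ℂ) - z₀))⁻¹ = Real.pi / z₀.im := by
  have h1 : ∀ x : ℝ, (((x : ℂ) - (starRingEnd ℂ) z₀) * ((x : ℂ) - z₀))⁻¹ =
      (((z₀.im ^ 2)⁻¹ * (1 + ((x - z₀.re) / z₀.im) ^ 2)⁻¹ : ℝ) : ℂ) := by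
    intro x
    rw [← mul_inv]
    push_cast
    rw [inv_inj]
    have hb : (z₀.im : ℂ) ≠ 0 := by exact_mod_cast hz₀.ne'
    have e : (starRingEnd ℂ) z₀ = z₀.re - z₀.im * Complex.I := by
      apply Complex.ext <;> simp
    rw [e]
    nth_rewrite 3 [← Complex.re_add_im z₀]
    field_simp
    linear_combination (-(z₀.im : ℂ) ^ 2) * Complex.I_sq
  simp_rw [h1]
  rw [integral_complex_ofReal, integral_const_mul,
    integral_sub_right_eq_self (fun x : ℝ => (1 + (x / z₀.im) ^ 2)⁻¹) z₀.re,
    Measure.integral_comp_div (fun x : ℝ => (1 + x ^ 2)⁻¹), integral_univ_inv_one_add_sq,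
    abs_of_pos hz₀, smul_eq_mul]
  push_cast
  have hb : (z₀.im : ℂ) ≠ 0 := by exact_mod_cast hz₀.ne'
  field_simp

namespace UpperBoundaryValues

variable {f g : ℂ → ℂ} {fp gp : ℝ → ℂ}

theorem integrable_and_integral_div_sub_eq_zero (h : UpperBoundaryValues f fp)
    (hO : f =O[upperInfty] fun z => 1 / z) {z₀ : ℂ} (hz₀ : z₀.im < 0) :
    Integrable (fun x : ℝ => fp x / (x - z₀)) ∧ ∫ x : ℝ, fp x / (x - z₀) = 0 := by
  have hb : UpperBoundaryValues (fun z : ℂ => (z - z₀)⁻¹) fun x : ℝ => ((x : ℂ) - z₀)⁻¹ := by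
    refine of_differentiableAt fun z hz => ?_
    refine (differentiableAt_fun_id.sub_const z₀).inv (sub_ne_zero.2 ?_)
    rintro rfl
    linarith
  have hm := h.mul hb
  have hO2 : (fun z : ℂ => f z * (z - z₀)⁻¹) =O[upperInfty] fun z => (1 / z) ^ 2 := by
    simpa only [sq] using hO.mul ((isBigO_inv_sub z₀).mono inf_le_left)
  exact ⟨hm.integrable_boundary hO2, hm.integral_boundary_eq_zero hO2⟩

/-- Cauchy's integral formula for the upper half plane. -/
theorem integrable_and_integral_div_sub (h : UpperBoundaryValues f fp)
    (hO : f =O[upperInfty] fun z => 1 / z) {z₀ : ℂ} (hz₀ : 0 < z₀.im) :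
    Integrable (fun x : ℝ => fp x / (x - z₀)) ∧
      ∫ x : ℝ, fp x / (x - z₀) = 2 * Real.pi * Complex.I * f z₀ := by
  -- Since `2i Im z₀ = z₀ - conj z₀`, the function `c / (z - conj z₀)` agrees with `f` at `z₀` and
  -- has its pole in the lower half plane. Subtracting it creates a zero at `z₀` without spoiling
  -- the decay.
  set c : ℂ := f z₀ * (2 * Complex.I * z₀.im) with hc
  have hconj : (starRingEnd ℂ) z₀ = z₀ - 2 * Complex.I * z₀.im := by
    apply Complex.ext <;> simp <;> ring
  have him : (z₀.im : ℂ) ≠ 0 := by exact_mod_cast hz₀.ne'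
  have hne : ∀ z : ℂ, 0 ≤ z.im → z - (starRingEnd ℂ) z₀ ≠ 0 := by
    intro z hz h0
    rw [sub_eq_zero] at h0
    rw [h0] at hz
    simp at hz
    linarith
  have hb : UpperBoundaryValues (fun z : ℂ => c * (z - (starRingEnd ℂ) z₀)⁻¹)
      fun x : ℝ => c * ((x : ℂ) - (starRingEnd ℂ) z₀)⁻¹ := by
    refine of_differentiableAt fun z hz => DifferentiableAt.const_mul ?_ c
    exact DifferentiableAt.fun_inv (differentiableAt_fun_id.sub_const _) (hne z hz)
  have hg := h.sub hb
  have hg0 : f z₀ - c * (z₀ - (starRingEnd ℂ) z₀)⁻¹ = 0 := by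
    rw [hconj, hc]
    field_simp
    ring
  have hgO : (fun z : ℂ => f z - c * (z - (starRingEnd ℂ) z₀)⁻¹) =O[upperInfty]
      fun z => 1 / z :=
    hO.sub (((isBigO_inv_sub _).mono inf_le_left).const_mul_left c)
  have hd := hg.dslope hz₀
  -- Because the numerator vanishes at `z₀`, the slope has no constant term over `z - z₀` and gains
  -- a full order of decay, as Cauchy's theorem requires.
  have hdO : _root_.dslope (fun z : ℂ => f z - c * (z - (starRingEnd ℂ) z₀)⁻¹) z₀ =O[upperInfty]
      fun z => (1 / z) ^ 2 := by
    have h2 := hgO.mul ((isBigO_inv_sub z₀).mono inf_le_left)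
    simp only [← sq] at h2
    refine h2.congr' ?_ EventuallyEq.rfl
    have hmem : {z : ℂ | z ≠ z₀} ∈ upperInfty := by
      refine mem_inf_of_left ?_
      filter_upwards [Filter.hasBasis_cobounded_norm.mem_of_mem (i := ‖z₀‖ + 1) trivial] with z hz
      have hz : ‖z₀‖ + 1 ≤ ‖z‖ := hz
      rintro rfl
      linarith
    filter_upwards [hmem] with z hz
    rw [dslope_of_ne _ hz, slope_def_field, hg0, sub_zero, div_eq_mul_inv]
  have hi := hd.integrable_boundary hdO
  have h0 := hd.integral_boundary_eq_zero hdO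
  simp only [hg0, sub_zero] at hi h0
  have hci : Integrable fun x : ℝ => c * (((x : ℂ) - (starRingEnd ℂ) z₀) * ((x : ℂ) - z₀))⁻¹ := by
    refine Integrable.const_mul ?_ c
    -- A non-integrable function has integral `0` by convention, whereas this integral is `π / Im z₀
    -- ≠ 0`.
    by_contra hni
    have := integral_inv_sub_mul_sub_conj hz₀
    rw [integral_undef hni] at this
    refine div_ne_zero ?_ him this.symm
    exact_mod_cast Real.pi_ne_zero
  have hsplit : (fun x : ℝ => fp x / (x - z₀)) = fun x : ℝ =>
      (fp x - c * ((x : ℂ) - (starRingEnd ℂ) z₀)⁻¹) / (x - z₀) +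
        c * (((x : ℂ) - (starRingEnd ℂ) z₀) * ((x : ℂ) - z₀))⁻¹ := by
    funext x
    rw [mul_inv]
    ring
  rw [hsplit]
  refine ⟨hi.add hci, ?_⟩
  rw [integral_add hi hci, h0, integral_const_mul, integral_inv_sub_mul_sub_conj hz₀, hc]
  field_simp
  ring

end UpperBoundaryValues

/-! ### Sectionally analytic functions and Liouville's theorem -/

/-- `f` is holomorphic off the real line with limits `fp x` and `fm x` at every real `x` from the
upper and the lower half plane. -/
structure BoundaryValues (f : ℂ → ℂ) (fp fm : ℝ → ℂ) : Prop where
  differentiableOn : DifferentiableOn ℂ f {z | z.im ≠ 0}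
  tendsto_plus : ∀ x : ℝ, Tendsto f (𝓝[{z | 0 < z.im}] (x : ℂ)) (𝓝 (fp x))
  tendsto_minus : ∀ x : ℝ, Tendsto f (𝓝[{z | z.im < 0}] (x : ℂ)) (𝓝 (fm x))

/-- The filter of non-real complex numbers tending to infinity. -/
noncomputable abbrev nonrealInfty : Filter ℂ := Bornology.cobounded ℂ ⊓ 𝓟 {z : ℂ | z.im ≠ 0}

theorem upperInfty_le_nonrealInfty : upperInfty ≤ nonrealInfty :=
  inf_le_inf_left _ (principal_mono.2 fun _ hz => ne_of_gt hz)

theorem tendsto_neg_nonrealInfty : Tendsto (fun z : ℂ => -z) nonrealInfty nonrealInfty := by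
  refine tendsto_inf.2 ⟨(tendsto_neg_cobounded (E := ℂ)).mono_left inf_le_left, ?_⟩
  refine tendsto_principal.2 (mem_inf_of_right ?_)
  intro z hz
  simpa using hz

theorem isBigO_comp_neg {f : ℂ → ℂ} (hO : f =O[nonrealInfty] fun z => 1 / z) :
    (fun z => f (-z)) =O[nonrealInfty] fun z => 1 / z := by
  refine (hO.comp_tendsto tendsto_neg_nonrealInfty).trans (Asymptotics.IsBigO.of_bound 1 ?_)
  exact Eventually.of_forall fun z => by simp

theorem tendsto_neg_nhdsWithin_upper (x : ℝ) :
    Tendsto (fun z : ℂ => -z) (𝓝[{z | 0 < z.im}] (x : ℂ)) (𝓝[{z | z.im < 0}] ((-x : ℝ) : ℂ)) := by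
  refine tendsto_nhdsWithin_iff.2 ⟨?_, ?_⟩
  · rw [Complex.ofReal_neg]
    exact (continuous_neg.tendsto _).mono_left nhdsWithin_le_nhds
  · filter_upwards [self_mem_nhdsWithin] with z hz
    simpa using hz

theorem tendsto_neg_nhdsWithin_lower (x : ℝ) :
    Tendsto (fun z : ℂ => -z) (𝓝[{z | z.im < 0}] (x : ℂ)) (𝓝[{z | 0 < z.im}] ((-x : ℝ) : ℂ)) := by
  refine tendsto_nhdsWithin_iff.2 ⟨?_, ?_⟩
  · rw [Complex.ofReal_neg]
    exact (continuous_neg.tendsto _).mono_left nhdsWithin_le_nhds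
  · filter_upwards [self_mem_nhdsWithin] with z hz
    simpa using hz

theorem isOpen_nonreal : IsOpen {z : ℂ | z.im ≠ 0} :=
  isOpen_ne_fun Complex.continuous_im continuous_const

theorem eventually_ne_nonrealInfty (z₀ : ℂ) : ∀ᶠ z in nonrealInfty, z ≠ z₀ := by
  refine mem_inf_of_left ?_
  filter_upwards [Filter.hasBasis_cobounded_norm.mem_of_mem (i := ‖z₀‖ + 1) trivial] with z hz
  have hz : ‖z₀‖ + 1 ≤ ‖z‖ := hz
  rintro rfl
  linarith

namespace BoundaryValues

variable {f g : ℂ → ℂ} {fp fm gp gm : ℝ → ℂ}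

theorem upper (h : BoundaryValues f fp fm) : UpperBoundaryValues f fp :=
  ⟨h.differentiableOn.mono fun _ hz => ne_of_gt hz, h.tendsto_plus⟩

/-- The reflection `z ↦ -z` exchanges the half planes, so results for the upper one transfer to the
lower one. -/
theorem comp_neg (h : BoundaryValues f fp fm) :
    BoundaryValues (fun z => f (-z)) (fun x => fm (-x)) fun x => fp (-x) where
  differentiableOn := h.differentiableOn.comp differentiable_neg.differentiableOn
    fun z hz => by simpa using hz
  tendsto_plus x := (h.tendsto_minus (-x)).comp (tendsto_neg_nhdsWithin_upper x)
  tendsto_minus x := (h.tendsto_plus (-x)).comp (tendsto_neg_nhdsWithin_lower x)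

theorem mul (h : BoundaryValues f fp fm) (h' : BoundaryValues g gp gm) :
    BoundaryValues (fun z => f z * g z) (fun x => fp x * gp x) fun x => fm x * gm x :=
  ⟨h.differentiableOn.mul h'.differentiableOn, fun x => (h.tendsto_plus x).mul (h'.tendsto_plus x),
    fun x => (h.tendsto_minus x).mul (h'.tendsto_minus x)⟩

theorem of_differentiable (h : Differentiable ℂ f) :
    BoundaryValues f (fun x => f x) fun x => f x :=
  ⟨h.differentiableOn, fun x => (h x).continuousAt.tendsto.mono_left nhdsWithin_le_nhds,
    fun x => (h x).continuousAt.tendsto.mono_left nhdsWithin_le_nhds⟩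

theorem sum {ι : Type*} (s : Finset ι) {f : ι → ℂ → ℂ} {fp fm : ι → ℝ → ℂ}
    (h : ∀ i ∈ s, BoundaryValues (f i) (fp i) (fm i)) :
    BoundaryValues (fun z => ∑ i ∈ s, f i z) (fun x => ∑ i ∈ s, fp i x)
      fun x => ∑ i ∈ s, fm i x where
  differentiableOn := DifferentiableOn.fun_sum fun i hi => (h i hi).differentiableOn
  tendsto_plus x := tendsto_finsetSum _ fun i hi => (h i hi).tendsto_plus x
  tendsto_minus x := tendsto_finsetSum _ fun i hi => (h i hi).tendsto_minus x

theorem prod {ι : Type*} (s : Finset ι) {f : ι → ℂ → ℂ} {fp fm : ι → ℝ → ℂ}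
    (h : ∀ i ∈ s, BoundaryValues (f i) (fp i) (fm i)) :
    BoundaryValues (fun z => ∏ i ∈ s, f i z) (fun x => ∏ i ∈ s, fp i x)
      fun x => ∏ i ∈ s, fm i x where
  differentiableOn := DifferentiableOn.fun_finsetProd fun i hi => (h i hi).differentiableOn
  tendsto_plus x := tendsto_finsetProd _ fun i hi => (h i hi).tendsto_plus x
  tendsto_minus x := tendsto_finsetProd _ fun i hi => (h i hi).tendsto_minus x

/-- Cauchy's formula for a sectionally analytic function decaying at infinity. -/
theorem integral_jump_div_sub (h : BoundaryValues f fp fm)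
    (hO : f =O[nonrealInfty] fun z => 1 / z) {z₀ : ℂ} (hz₀ : 0 < z₀.im) :
    ∫ x : ℝ, (fp x - fm x) / (x - z₀) = 2 * Real.pi * Complex.I * f z₀ := by
  obtain ⟨hi₁, h₁⟩ := h.upper.integrable_and_integral_div_sub
    (hO.mono upperInfty_le_nonrealInfty) hz₀
  have hO' : (fun z => f (-z)) =O[nonrealInfty] fun z => 1 / z :=
    isBigO_comp_neg hO
  -- After reflection the lower boundary values belong to a function on the upper half plane, while
  -- the pole `-z₀` lies below the axis. They contribute nothing.
  obtain ⟨hi₂, h₂⟩ := h.comp_neg.upper.integrable_and_integral_div_sub_eq_zero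
    (hO'.mono upperInfty_le_nonrealInfty) (z₀ := -z₀) (by simpa using hz₀)
  have hi₃ : Integrable fun x : ℝ => fm x / (x - z₀) := by
    have := hi₂.comp_neg.neg
    refine this.congr (Eventually.of_forall fun x => ?_)
    simp only [Pi.neg_apply, neg_neg, Complex.ofReal_neg, sub_neg_eq_add]
    rw [← div_neg, neg_add, neg_neg, sub_eq_add_neg]
  have h₃ : ∫ x : ℝ, fm x / (x - z₀) = 0 := by
    rw [← integral_neg_eq_self]
    rw [← neg_eq_zero, ← integral_neg, ← h₂]
    refine integral_congr_ae (Eventually.of_forall fun x => ?_)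
    simp only [Complex.ofReal_neg]
    rw [← div_neg]
    ring_nf
  simp_rw [sub_div]
  rw [integral_sub hi₁ hi₃, h₁, h₃, sub_zero]

theorem eq_zero_of_isBigO (h : BoundaryValues f fp fp)
    (hO : f =O[nonrealInfty] fun z => 1 / z) {z : ℂ} (hz : z.im ≠ 0) : f z = 0 := by
  have key : ∀ {f : ℂ → ℂ} {fp : ℝ → ℂ}, BoundaryValues f fp fp →
      (f =O[nonrealInfty] fun z => 1 / z) → ∀ {z : ℂ}, 0 < z.im → f z = 0 := by
    intro f fp h hO z hz
    have := h.integral_jump_div_sub hO hz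
    simpa [Real.pi_ne_zero] using this.symm
  rcases hz.lt_or_gt with hz | hz
  · have hO' : (fun z => f (-z)) =O[nonrealInfty] fun z => 1 / z :=
      isBigO_comp_neg hO
    simpa using key h.comp_neg hO' (z := -z) (by simpa using hz)
  · exact key h hO hz

theorem dslope (h : BoundaryValues f fp fm) {z₀ : ℂ} (hz₀ : z₀.im ≠ 0) :
    BoundaryValues (dslope f z₀) (fun x => (fp x - f z₀) / (x - z₀))
      fun x => (fm x - f z₀) / (x - z₀) := by
  have key : ∀ (x : ℝ) (s : Set ℂ) (a : ℂ), Tendsto f (𝓝[s] (x : ℂ)) (𝓝 a) →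
      Tendsto (_root_.dslope f z₀) (𝓝[s] (x : ℂ)) (𝓝 ((a - f z₀) / (x - z₀))) := by
    intro x s a ha
    have hne : (x : ℂ) ≠ z₀ := by
      rintro rfl
      simp at hz₀
    have hlim : Tendsto (fun z : ℂ => (f z - f z₀) / (z - z₀))
        (𝓝[s] (x : ℂ)) (𝓝 ((a - f z₀) / (x - z₀))) :=
      (ha.sub_const _).div
        (((continuous_id.sub continuous_const).continuousAt.tendsto).mono_left nhdsWithin_le_nhds)
        (sub_ne_zero.2 hne)
    refine hlim.congr' ?_
    filter_upwards [nhdsWithin_le_nhds (isOpen_ne.mem_nhds hne)] with z hz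
    rw [dslope_of_ne _ hz, slope_def_field]
  exact ⟨(Complex.differentiableOn_dslope (isOpen_nonreal.mem_nhds hz₀)).2 h.differentiableOn,
    fun x => key x _ _ (h.tendsto_plus x), fun x => key x _ _ (h.tendsto_minus x)⟩

/-- A function of polynomial growth that has no jump on the real line is a polynomial. -/
theorem exists_polynomial (h : BoundaryValues f fp fp) {N : ℕ}
    (hO : f =O[nonrealInfty] fun z => z ^ N * (1 / z)) :
    ∃ P : ℂ[X], P.degree < (N : WithBot ℕ) ∧ (∀ z : ℂ, z.im ≠ 0 → f z = P.eval z) ∧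
      ∀ x : ℝ, fp x = P.eval (x : ℂ) := by
  suffices hs : ∃ P : ℂ[X], P.degree < (N : WithBot ℕ) ∧ ∀ z : ℂ, z.im ≠ 0 → f z = P.eval z by
    obtain ⟨P, hP, hfP⟩ := hs
    refine ⟨P, hP, hfP, fun x => ?_⟩
    have := nhdsWithin_upper_neBot x
    refine tendsto_nhds_unique (h.tendsto_plus x)
      ((P.continuous.continuousAt.tendsto.mono_left nhdsWithin_le_nhds).congr' ?_)
    filter_upwards [self_mem_nhdsWithin] with z hz using (hfP z (ne_of_gt hz)).symm
  -- The bound `z ^ N * (1 / z)` makes `N = 0` the decaying case, where Cauchy's formula with zero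
  -- jump forces `f = 0`. The slope at the nonreal point `I` lowers `N` by one and still has no
  -- jump.
  induction N generalizing f fp with
  | zero =>
    refine ⟨0, by simp, fun z hz => ?_⟩
    rw [eval_zero]
    exact h.eq_zero_of_isBigO (by simpa using hO) hz
  | succ N ih =>
    have hI : Complex.I.im ≠ 0 := by simp
    have hO1 : _root_.dslope f Complex.I =O[nonrealInfty] fun z => z ^ N * (1 / z) := by
      have hc : (fun _ : ℂ => f Complex.I) =O[nonrealInfty] fun z => z ^ (N + 1) * (1 / z) := by
        refine Asymptotics.IsBigO.of_bound ‖f Complex.I‖ ?_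
        refine mem_inf_of_left ?_
        filter_upwards [Filter.hasBasis_cobounded_norm.mem_of_mem (i := 1) trivial] with z hz
        have hz : 1 ≤ ‖z‖ := hz
        have hz0 : z ≠ 0 := norm_pos_iff.1 (zero_lt_one.trans_le hz)
        have : z ^ (N + 1) * (1 / z) = z ^ N := by
          field_simp
          ring
        rw [this, norm_pow]
        exact le_mul_of_one_le_right (norm_nonneg _) (one_le_pow₀ hz)
      have h2 := (hO.sub hc).mul ((isBigO_inv_sub Complex.I).mono inf_le_left)
      refine h2.congr' ?_ ?_
      · filter_upwards [eventually_ne_nonrealInfty Complex.I] with z hz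
        rw [dslope_of_ne _ hz, slope_def_field, div_eq_mul_inv]
      · filter_upwards [eventually_ne_nonrealInfty 0] with z hz
        field_simp
        ring
    obtain ⟨P, hP, hfP⟩ := ih (h.dslope hI) hO1
    refine ⟨C (f Complex.I) + (X - C Complex.I) * P, ?_, fun z hz => ?_⟩
    · rw [degree_lt_iff_coeff_zero] at hP ⊢
      rintro (_ | k) hk
      · omega
      · simp [sub_mul, coeff_C_succ, hP k (by omega), hP (k + 1) (by omega)]
    · have := sub_smul_dslope f Complex.I z
      rw [hfP z hz] at this
      simp only [smul_eq_mul] at this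
      simp [this]

end BoundaryValues

theorem nonrealInfty_neBot : nonrealInfty.NeBot := by
  have : Tendsto (fun t : ℝ => (t : ℂ) * Complex.I) atTop nonrealInfty := by
    refine tendsto_inf.2 ⟨?_, tendsto_principal.2 ?_⟩
    · rw [← tendsto_norm_atTop_iff_cobounded]
      simpa using tendsto_abs_atTop_atTop
    · filter_upwards [eventually_gt_atTop 0] with t ht
      simpa using ht.ne'
  exact this.neBot

theorem isBigO_one_of_degree_lt {P : ℂ[X]} {N : ℕ} (hP : P.degree < (N : WithBot ℕ)) :
    (fun z => P.eval z) =O[nonrealInfty] fun z => z ^ N * (1 / z) := by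
  have hsum : (fun z => P.eval z) = fun z => ∑ i ∈ Finset.range N, P.coeff i * z ^ i := by
    funext z
    rw [eval_eq_sum, ← P.sum_fin (fun i a => a * z ^ i) (by simp) hP,
      Finset.sum_range (fun i => P.coeff i * z ^ i)]
  rw [hsum]
  refine Asymptotics.IsBigO.fun_sum fun i hi => Asymptotics.IsBigO.const_mul_left ?_ _
  refine Asymptotics.IsBigO.of_bound 1 (mem_inf_of_left ?_)
  filter_upwards [Filter.hasBasis_cobounded_norm.mem_of_mem (i := 1) trivial] with z hz
  have hz : 1 ≤ ‖z‖ := hz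
  have hz0 : z ≠ 0 := norm_pos_iff.1 (zero_lt_one.trans_le hz)
  obtain ⟨M, rfl⟩ : ∃ M, N = M + 1 := ⟨N - 1, by have := Finset.mem_range.1 hi; omega⟩
  have : z ^ (M + 1) * (1 / z) = z ^ M := by
    field_simp
    ring
  rw [this, norm_pow, norm_pow, one_mul]
  exact pow_le_pow_right₀ hz (by have := Finset.mem_range.1 hi; omega)

/-! ### Determinants and adjugates -/

section Matrix

variable {ι : Type*} [Fintype ι] [DecidableEq ι]

theorem BoundaryValues.det {M : ℂ → Matrix ι ι ℂ} {Mp Mm : ℝ → Matrix ι ι ℂ}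
    (h : ∀ i j, BoundaryValues (fun z => M z i j) (fun x => Mp x i j) fun x => Mm x i j) :
    BoundaryValues (fun z => (M z).det) (fun x => (Mp x).det) fun x => (Mm x).det := by
  simp only [Matrix.det_apply']
  exact BoundaryValues.sum _ fun σ _ => (BoundaryValues.of_differentiable
    (differentiable_const _)).mul (BoundaryValues.prod _ fun i _ => h _ _)

/-- Adjugate entries are polynomial in the matrix entries, so analyticity and boundary values pass
to them with no prior knowledge of invertibility. -/
theorem BoundaryValues.adjugate {M : ℂ → Matrix ι ι ℂ} {Mp Mm : ℝ → Matrix ι ι ℂ}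
    (h : ∀ i j, BoundaryValues (fun z => M z i j) (fun x => Mp x i j) fun x => Mm x i j)
    (i j : ι) : BoundaryValues (fun z => (M z).adjugate i j) (fun x => (Mp x).adjugate i j)
      fun x => (Mm x).adjugate i j := by
  simp only [Matrix.adjugate_apply]
  refine BoundaryValues.det fun a b => ?_
  simp only [Matrix.updateRow_apply]
  split_ifs
  · exact BoundaryValues.of_differentiable (differentiable_const _)
  · exact h a b

theorem eq_adjugate_of_mul_eq_one {M M' : Matrix ι ι ℂ} (hd : M.det = 1) (h : M' * M = 1) :
    M.adjugate = M' := by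
  calc M.adjugate = (M' * M) * M.adjugate := by rw [h, one_mul]
    _ = M' := by rw [mul_assoc, Matrix.mul_adjugate, hd, one_smul, mul_one]

end Matrix

section Jump

variable {p q : ℕ} (w₁ : Fin p → ℝ → ℝ) (w₂ : Fin q → ℝ → ℝ)

theorem det_jumpMatrix (x : ℝ) : (jumpMatrix w₁ w₂ x).det = 1 := by
  simp [jumpMatrix]

theorem adjugate_jumpMatrix (x : ℝ) : (jumpMatrix w₁ w₂ x).adjugate =
    Matrix.fromBlocks 1 (-weightMatrix w₁ w₂ x) 0 1 := by
  refine eq_adjugate_of_mul_eq_one (det_jumpMatrix w₁ w₂ x) ?_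
  simp [jumpMatrix, Matrix.fromBlocks_multiply]

end Jump

/-- The balance `|n| = |m|` makes the powers of `z` cancel; this is what normalizes `det Y` at
infinity. -/
theorem det_asymptoticFactor {p q : ℕ} {n : Fin p → ℕ} {m : Fin q → ℕ}
    (hnm : ∑ k, n k = ∑ l, m l) {z : ℂ} (hz : z ≠ 0) : (asymptoticFactor n m z).det = 1 := by
  simp only [asymptoticFactor, Matrix.det_diagonal, Fintype.prod_sum_type, Sum.elim_inl,
    Sum.elim_inr, zpow_neg, zpow_natCast, Finset.prod_pow_eq_pow_sum, Finset.prod_inv_distrib]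
  rw [hnm, mul_inv_cancel₀ (pow_ne_zero _ hz)]

theorem adjugate_asymptoticFactor {p q : ℕ} {n : Fin p → ℕ} {m : Fin q → ℕ}
    (hnm : ∑ k, n k = ∑ l, m l) {z : ℂ} (hz : z ≠ 0) : (asymptoticFactor n m z).adjugate =
      Matrix.diagonal (Sum.elim (fun k => (z ^ n k)⁻¹) fun l => z ^ m l) := by
  refine eq_adjugate_of_mul_eq_one (det_asymptoticFactor hnm hz) ?_
  rw [asymptoticFactor, Matrix.diagonal_mul_diagonal, ← Matrix.diagonal_one]
  congr 1
  funext i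
  rcases i with k | l
  · simp [inv_mul_cancel₀ (pow_ne_zero _ hz)]
  · simp [mul_inv_cancel₀ (pow_ne_zero _ hz)]

theorem ne_zero_of_im_ne_zero {z : ℂ} (hz : z.im ≠ 0) : z ≠ 0 := by
  rintro rfl
  simp at hz

/-! ### Divided differences -/

/-- The divided difference `∑ᵢ Aᵢ(z) Bᵢ(y) / (z - y)`, as a polynomial in `y`, when
`∑ᵢ Aᵢ(z) Bᵢ(z) = 0`. -/
noncomputable def dividedDifference {ι : Type*} [Fintype ι] (A B : ι → ℂ[X])
    (z : ℂ) : ℂ[X] :=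
  -∑ i, C ((A i).eval z) * (B i /ₘ (X - C z))

theorem sub_mul_eval_dividedDifference {ι : Type*} [Fintype ι] (A B : ι → ℂ[X])
    {z : ℂ} (h : ∑ i, (A i).eval z * (B i).eval z = 0) (y : ℂ) :
    (z - y) * (dividedDifference A B z).eval y = ∑ i, (A i).eval z * (B i).eval y := by
  have h1 : ∀ i, (B i).eval y = (B i).eval z + (y - z) * (B i /ₘ (X - C z)).eval y := by
    intro i
    conv_lhs => rw [← modByMonic_add_div (B i) (X - C z), modByMonic_X_sub_C_eq_C_eval]
    simp
  simp_rw [h1, mul_add, Finset.sum_add_distrib]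
  rw [h, zero_add, dividedDifference, eval_neg, eval_finsetSum, mul_neg, Finset.mul_sum,
    ← Finset.sum_neg_distrib]
  refine Finset.sum_congr rfl fun i _ => ?_
  rw [eval_mul, eval_C]
  ring

/-- The drop by one degree is what places the resulting form in `formSpace w₂ m`: rows of the
inverse have degree at most `m l`, the forms need degree less than `m l`. -/
theorem degree_dividedDifference_lt {ι : Type*} [Fintype ι] (A B : ι → ℂ[X])
    (z : ℂ) {N : ℕ} (hB : ∀ i, (B i).degree < ((N + 1 : ℕ) : WithBot ℕ)) :
    (dividedDifference A B z).degree < (N : WithBot ℕ) := by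
  rw [degree_lt_iff_coeff_zero]
  intro k hk
  rw [dividedDifference, coeff_neg, finsetSum_coeff, neg_eq_zero]
  refine Finset.sum_eq_zero fun i _ => ?_
  rw [coeff_C_mul, coeff_divByMonic_X_sub_C, Finset.sum_eq_zero, mul_zero]
  intro j hj
  rw [(degree_lt_iff_coeff_zero _ _).1 (hB i) j (by have := (Finset.mem_Icc.1 hj).1; omega),
    mul_zero]

theorem continuous_coeff_dividedDifference {ι : Type*} [Fintype ι]
    (A B : ι → ℂ[X]) (k : ℕ) : Continuous fun z => (dividedDifference A B z).coeff k := by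
  simp only [dividedDifference, coeff_neg, finsetSum_coeff, coeff_C_mul,
    coeff_divByMonic_X_sub_C]
  fun_prop

/-! ### Structure of a solution and the reproducing property -/

namespace IsRHSolution

variable {p q : ℕ} {w₁ : Fin p → ℝ → ℝ} {w₂ : Fin q → ℝ → ℝ} {n : Fin p → ℕ} {m : Fin q → ℕ}
  {Y : ℂ → Matrix (Fin p ⊕ Fin q) (Fin p ⊕ Fin q) ℂ}
  {Yplus Yminus : ℝ → Matrix (Fin p ⊕ Fin q) (Fin p ⊕ Fin q) ℂ}

theorem boundaryValues (h : IsRHSolution w₁ w₂ n m Y Yplus Yminus) (i j : Fin p ⊕ Fin q) :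
    BoundaryValues (fun z => Y z i j) (fun x => Yplus x i j) fun x => Yminus x i j where
  differentiableOn := h.analytic i j
  tendsto_plus x := tendsto_pi_nhds.1 (tendsto_pi_nhds.1 (h.tendsto_plus x) i) j
  tendsto_minus x := tendsto_pi_nhds.1 (tendsto_pi_nhds.1 (h.tendsto_minus x) i) j

theorem exists_factor (h : IsRHSolution w₁ w₂ n m Y Yplus Yminus) :
    ∃ R : ℂ → Matrix (Fin p ⊕ Fin q) (Fin p ⊕ Fin q) ℂ, Tendsto R nonrealInfty (𝓝 1) ∧
      ∀ z : ℂ, z.im ≠ 0 → Y z = R z * asymptoticFactor n m z := by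
  obtain ⟨E, hE, hY⟩ := h.asymptotics
  refine ⟨fun z => 1 + E z, ?_, hY⟩
  have hE0 : Tendsto E nonrealInfty (𝓝 0) := by
    refine tendsto_pi_nhds.2 fun i => tendsto_pi_nhds.2 fun j => ?_
    refine (hE i j).trans_tendsto ?_
    simp only [one_div]
    exact tendsto_inv₀_cobounded.mono_left inf_le_left
  simpa using hE0.const_add 1

theorem det_plus_eq_det_minus (h : IsRHSolution w₁ w₂ n m Y Yplus Yminus) (x : ℝ) :
    (Yplus x).det = (Yminus x).det := by
  rw [h.jump, Matrix.det_mul, det_jumpMatrix, mul_one]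

/-- Liouville's argument: the jump matrix has determinant `1`, so `det Y` has no jump, and its limit
at infinity is `1`. -/
theorem det_eq_one (h : IsRHSolution w₁ w₂ n m Y Yplus Yminus) (hnm : ∑ k, n k = ∑ l, m l) :
    (∀ z : ℂ, z.im ≠ 0 → (Y z).det = 1) ∧ ∀ x : ℝ, (Yplus x).det = 1 := by
  obtain ⟨R, hR, hY⟩ := h.exists_factor
  have hdet : ∀ z : ℂ, z.im ≠ 0 → (Y z).det = (R z).det := fun z hz => by
    rw [hY z hz, Matrix.det_mul, det_asymptoticFactor hnm (ne_zero_of_im_ne_zero hz), mul_one]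
  have hlim : Tendsto (fun z => (Y z).det) nonrealInfty (𝓝 1) := by
    have h1 : Tendsto (fun z => (R z).det) nonrealInfty (𝓝 1) := by
      simpa [Function.comp_def] using ((continuous_id.matrix_det).tendsto
        (1 : Matrix (Fin p ⊕ Fin q) (Fin p ⊕ Fin q) ℂ)).comp hR
    refine h1.congr' (mem_inf_of_right fun z hz => (hdet z hz).symm)
  have hbv := BoundaryValues.det h.boundaryValues
  have he : (fun x => (Yminus x).det) = fun x => (Yplus x).det :=
    funext fun x => (h.det_plus_eq_det_minus x).symm
  rw [he] at hbv
  obtain ⟨P, hP, hPY, hPp⟩ := hbv.exists_polynomial (N := 1) (by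
    refine (hlim.isBigO_one ℂ).congr' EventuallyEq.rfl ?_
    filter_upwards [eventually_ne_nonrealInfty 0] with z hz
    field_simp)
  have hPc : P = C (P.coeff 0) := eq_C_of_degree_le_zero (by
    have : P.degree < ((0 + 1 : ℕ) : WithBot ℕ) := by simpa using hP
    simpa using Order.le_of_lt_succ this)
  have hc : P.coeff 0 = 1 := by
    have := nonrealInfty_neBot
    refine tendsto_nhds_unique (f := fun _ : ℂ => P.coeff 0) (l := nonrealInfty)
      tendsto_const_nhds (hlim.congr' (mem_inf_of_right fun z hz => ?_))
    change (Y z).det = P.coeff 0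
    rw [hPY z hz, hPc]
    simp
  rw [hc, C_1] at hPc
  exact ⟨fun z hz => by rw [hPY z hz, hPc, eval_one], fun x => by rw [hPp x, hPc, eval_one]⟩

theorem isBigO_entry_inl (h : IsRHSolution w₁ w₂ n m Y Yplus Yminus) (i : Fin p ⊕ Fin q)
    (k : Fin p) : (fun z => Y z i (Sum.inl k)) =O[nonrealInfty] fun z => z ^ n k := by
  obtain ⟨R, hR, hY⟩ := h.exists_factor
  have h1 := (tendsto_pi_nhds.1 (tendsto_pi_nhds.1 hR i) (Sum.inl k)).isBigO_one ℂ
  refine (h1.mul (Asymptotics.isBigO_refl (fun z : ℂ => z ^ n k) nonrealInfty)).congr' ?_ ?_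
  · refine mem_inf_of_right fun z hz => ?_
    simp [hY z hz, asymptoticFactor]
  · exact Eventually.of_forall fun z => one_mul _

/-- The adjugate reverses products, so the inverse powers stand on the left and govern rows,
multiplied by the adjugate of a factor tending to `1`. -/
theorem isBigO_adjugate (h : IsRHSolution w₁ w₂ n m Y Yplus Yminus) (hnm : ∑ k, n k = ∑ l, m l)
    (i j : Fin p ⊕ Fin q) : (fun z => (Y z).adjugate i j) =O[nonrealInfty]
      fun z => Sum.elim (fun k => (z ^ n k)⁻¹) (fun l => z ^ m l) i := by
  obtain ⟨R, hR, hY⟩ := h.exists_factor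
  have hadj : Tendsto (fun z => (R z).adjugate) nonrealInfty
      (𝓝 (1 : Matrix (Fin p ⊕ Fin q) (Fin p ⊕ Fin q) ℂ).adjugate) :=
    ((continuous_id.matrix_adjugate).tendsto
      (1 : Matrix (Fin p ⊕ Fin q) (Fin p ⊕ Fin q) ℂ)).comp hR
  have h1 := (tendsto_pi_nhds.1 (tendsto_pi_nhds.1 hadj i) j).isBigO_one ℂ
  refine ((Asymptotics.isBigO_refl (fun z : ℂ => Sum.elim (fun k => (z ^ n k)⁻¹)
    (fun l => z ^ m l) i) nonrealInfty).mul h1).congr' ?_ ?_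
  · refine mem_inf_of_right fun z hz => ?_
    simp [hY z hz, Matrix.adjugate_mul_distrib,
      adjugate_asymptoticFactor hnm (ne_zero_of_im_ne_zero hz), Matrix.diagonal_mul]
  · exact Eventually.of_forall fun z => mul_one _

theorem plus_inl (h : IsRHSolution w₁ w₂ n m Y Yplus Yminus) (x : ℝ) (i : Fin p ⊕ Fin q)
    (k : Fin p) : Yplus x i (Sum.inl k) = Yminus x i (Sum.inl k) := by
  simp [h.jump, jumpMatrix, Matrix.mul_apply, Fintype.sum_sum_type, Matrix.one_apply]

theorem adjugate_plus (h : IsRHSolution w₁ w₂ n m Y Yplus Yminus) (x : ℝ) :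
    (Yplus x).adjugate =
      Matrix.fromBlocks 1 (-weightMatrix w₁ w₂ x) 0 1 * (Yminus x).adjugate := by
  rw [h.jump, Matrix.adjugate_mul_distrib, adjugate_jumpMatrix]

theorem adjugate_plus_inr (h : IsRHSolution w₁ w₂ n m Y Yplus Yminus) (x : ℝ) (l : Fin q)
    (i : Fin p ⊕ Fin q) :
    (Yplus x).adjugate (Sum.inr l) i = (Yminus x).adjugate (Sum.inr l) i := by
  simp [h.adjugate_plus, Matrix.mul_apply, Fintype.sum_sum_type, Matrix.one_apply]

theorem adjugate_plus_inl (h : IsRHSolution w₁ w₂ n m Y Yplus Yminus) (x : ℝ) (k : Fin p)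
    (i : Fin p ⊕ Fin q) : (Yplus x).adjugate (Sum.inl k) i =
      (Yminus x).adjugate (Sum.inl k) i -
        ∑ l, w₁ k x * w₂ l x * (Yplus x).adjugate (Sum.inr l) i := by
  simp only [h.adjugate_plus_inr]
  simp [h.adjugate_plus, Matrix.mul_apply, Fintype.sum_sum_type, Matrix.one_apply,
    weightMatrix, sub_eq_add_neg]

/-- The first `p` columns of a solution are polynomials. -/
theorem exists_polynomial_column (h : IsRHSolution w₁ w₂ n m Y Yplus Yminus)
    (i : Fin p ⊕ Fin q) (k : Fin p) :
    ∃ P : ℂ[X], (∀ z : ℂ, z.im ≠ 0 → Y z i (Sum.inl k) = P.eval z) ∧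
      ∀ x : ℝ, Yplus x i (Sum.inl k) = P.eval (x : ℂ) := by
  have hbv := h.boundaryValues i (Sum.inl k)
  simp only [← h.plus_inl] at hbv
  obtain ⟨P, -, hP⟩ := hbv.exists_polynomial (N := n k + 1) (by
    refine (h.isBigO_entry_inl i k).congr' EventuallyEq.rfl ?_
    filter_upwards [eventually_ne_nonrealInfty 0] with z hz
    field_simp
    ring)
  exact ⟨P, hP⟩

/-- The last `q` rows of the inverse of a solution are polynomials. -/
theorem exists_polynomial_row (h : IsRHSolution w₁ w₂ n m Y Yplus Yminus)
    (hnm : ∑ k, n k = ∑ l, m l) (l : Fin q) (i : Fin p ⊕ Fin q) :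
    ∃ P : ℂ[X], P.degree < ((m l + 1 : ℕ) : WithBot ℕ) ∧
      (∀ z : ℂ, z.im ≠ 0 → (Y z).adjugate (Sum.inr l) i = P.eval z) ∧
      ∀ x : ℝ, (Yplus x).adjugate (Sum.inr l) i = P.eval (x : ℂ) := by
  have hbv := BoundaryValues.adjugate h.boundaryValues (Sum.inr l) i
  simp only [← h.adjugate_plus_inr] at hbv
  refine hbv.exists_polynomial ((h.isBigO_adjugate hnm (Sum.inr l) i).congr' EventuallyEq.rfl ?_)
  filter_upwards [eventually_ne_nonrealInfty 0] with z hz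
  simp only [Sum.elim_inr]
  field_simp
  ring

/-- The reproducing property of the kernel built from a solution, off the real line. -/
theorem integral_dividedDifference_mul_linForm (h : IsRHSolution w₁ w₂ n m Y Yplus Yminus)
    (hnm : ∑ k, n k = ∑ l, m l) {A : Fin p ⊕ Fin q → Fin p → ℂ[X]}
    (hA : ∀ i k, ∀ z : ℂ, z.im ≠ 0 → Y z i (Sum.inl k) = (A i k).eval z)
    {B : Fin q → Fin p ⊕ Fin q → ℂ[X]}
    (hB : ∀ l i, ∀ z : ℂ, z.im ≠ 0 → (Y z).adjugate (Sum.inr l) i = (B l i).eval z)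
    (hBp : ∀ l i, ∀ x : ℝ, (Yplus x).adjugate (Sum.inr l) i = (B l i).eval (x : ℂ))
    {P : Fin p → ℝ[X]} (hP : ∀ k, (P k).degree < (n k : WithBot ℕ)) (k : Fin p) {z : ℂ}
    (hz : 0 < z.im) :
    ∫ y : ℝ, (∑ l, (dividedDifference (fun i => A i k) (B l) z).eval (y : ℂ) * w₂ l y) *
        linForm w₁ P y = 2 * Real.pi * Complex.I * ((P k).map (algebraMap ℝ ℂ)).eval z := by
  have hdet := (h.det_eq_one hnm).1 z hz.ne'
  have hinv : ∀ i j, ∑ a, (Y z).adjugate i a * Y z a j = if i = j then 1 else 0 := by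
    intro i j
    rw [← Matrix.mul_apply, Matrix.adjugate_mul, hdet, one_smul, Matrix.one_apply]
  set Pc : Fin p → ℂ[X] := fun j => (P j).map (algebraMap ℝ ℂ) with hPc
  have hPcr : ∀ j (y : ℝ), (Pc j).eval (y : ℂ) = (P j).eval y := fun j y =>
    (eval_map _ _).trans (eval₂_at_apply (algebraMap ℝ ℂ) y)
  have hbv : BoundaryValues
      (fun z' => ∑ i, (A i k).eval z * ∑ j, (Pc j).eval z' * (Y z').adjugate (Sum.inl j) i)
      (fun x => ∑ i, (A i k).eval z *
        ∑ j, (Pc j).eval (x : ℂ) * (Yplus x).adjugate (Sum.inl j) i)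
      (fun x => ∑ i, (A i k).eval z *
        ∑ j, (Pc j).eval (x : ℂ) * (Yminus x).adjugate (Sum.inl j) i) := by
    refine BoundaryValues.sum _ fun i _ => (BoundaryValues.of_differentiable
      (differentiable_const _)).mul (BoundaryValues.sum _ fun j _ =>
        (BoundaryValues.of_differentiable (Pc j).differentiable).mul
          (BoundaryValues.adjugate h.boundaryValues _ _))
  -- Row `j` of the inverse is `O(ζ^(-n j))`, and `P j` has degree below `n j`; the product is
  -- `O(1/ζ)`.
  have hO : (fun z' => ∑ i, (A i k).eval z *
      ∑ j, (Pc j).eval z' * (Y z').adjugate (Sum.inl j) i) =O[nonrealInfty] fun z => 1 / z := by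
    refine Asymptotics.IsBigO.fun_sum fun i _ => Asymptotics.IsBigO.const_mul_left
      (Asymptotics.IsBigO.fun_sum fun j _ => ?_) _
    have h1 : (Pc j).degree < (n j : WithBot ℕ) := (degree_map_le).trans_lt (hP j)
    refine ((isBigO_one_of_degree_lt h1).mul (h.isBigO_adjugate hnm (Sum.inl j) i)).congr'
      EventuallyEq.rfl ?_
    filter_upwards [eventually_ne_nonrealInfty 0] with z hz
    simp only [Sum.elim_inl]
    field_simp
  have hC := hbv.integral_jump_div_sub hO hz
  -- At `ζ = z` the product `Y⁻¹(z) Y(z)` is the identity, which selects the index `k`.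
  have hval : ∑ i, (A i k).eval z * ∑ j, (Pc j).eval z * (Y z).adjugate (Sum.inl j) i =
      (Pc k).eval z := by
    simp_rw [← hA _ _ z hz.ne', Finset.mul_sum]
    rw [Finset.sum_comm]
    calc _ = ∑ j, (Pc j).eval z * ∑ i, (Y z).adjugate (Sum.inl j) i * Y z i (Sum.inl k) := by
          refine Finset.sum_congr rfl fun j _ => ?_
          rw [Finset.mul_sum]
          exact Finset.sum_congr rfl fun i _ => by ring
      _ = _ := by simp [hinv]
  rw [hval] at hC
  rw [← hC]
  refine integral_congr_ae (Eventually.of_forall fun y => ?_)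
  have hne : (y : ℂ) - z ≠ 0 := by
    rw [sub_ne_zero]
    rintro rfl
    simp at hz
  -- The vanishing needed here is an off-diagonal entry of `Y⁻¹(z) Y(z) = 1`. The minus sign cancels
  -- the one in the jump of the upper rows of the inverse.
  have hDD : ∀ l, (dividedDifference (fun i => A i k) (B l) z).eval (y : ℂ) =
      -(∑ i, (A i k).eval z * (B l i).eval (y : ℂ)) / (y - z) := by
    intro l
    rw [← sub_mul_eval_dividedDifference]
    · field_simp
      ring
    · simp_rw [← hA _ _ z hz.ne', ← hB _ _ z hz.ne', mul_comm (Y z _ _)]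
      simp [hinv]
  simp only [h.adjugate_plus_inl, hBp, hDD, hPcr, linForm]
  push_cast
  rw [← Finset.sum_sub_distrib, eq_div_iff hne]
  simp_rw [← mul_sub, ← Finset.sum_sub_distrib, ← mul_sub, sub_sub_cancel_left]
  simp only [div_mul_eq_mul_div, ← Finset.sum_div]
  rw [mul_div_cancel_right₀ _ hne]
  simp only [Finset.mul_sum, Finset.sum_mul, neg_mul, mul_neg, Finset.sum_neg_distrib, neg_inj]
  rw [eq_comm, Finset.sum_comm]
  refine Finset.sum_congr rfl fun j _ => ?_
  rw [Finset.sum_comm]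
  exact Finset.sum_congr rfl fun l _ => Finset.sum_congr rfl fun i _ => by ring

end IsRHSolution

/-! ### Form spaces and biorthogonal bases -/

theorem memLp_of_mem_formSpace {r : ℕ} {w : Fin r → ℝ → ℝ} {n : Fin r → ℕ}
    (hL : ∀ k, ∀ j < n k, MemLp (fun x : ℝ => x ^ j * w k x) 2 volume) {f : ℝ → ℝ}
    (hf : f ∈ formSpace w n) : MemLp f 2 volume := by
  obtain ⟨A, hA, rfl⟩ := hf
  refine memLp_finsetSum _ fun k _ => ?_
  have hsum : (fun x => (A k).eval x * w k x) =
      fun x => ∑ i : Fin (n k), (A k).coeff i * (x ^ (i : ℕ) * w k x) := by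
    funext x
    rw [eval_eq_sum, ← (A k).sum_fin (fun i a => a * x ^ i) (by simp) (hA k), Finset.sum_mul]
    exact Finset.sum_congr rfl fun i _ => by ring
  rw [hsum]
  exact memLp_finsetSum _ fun i _ => (hL k i i.2).const_mul _

theorem pow_mul_mem_formSpace {r : ℕ} (w : Fin r → ℝ → ℝ) {n : Fin r → ℕ} (k : Fin r) {j : ℕ}
    (hj : j < n k) : (fun x : ℝ => x ^ j * w k x) ∈ formSpace w n := by
  refine ⟨fun i => if i = k then X ^ j else 0, fun i => ?_, ?_⟩
  · dsimp only
    split_ifs with h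
    · rw [h, degree_X_pow]
      exact_mod_cast hj
    · rw [degree_zero]
      exact WithBot.bot_lt_coe _
  · funext x
    simp [linForm, apply_ite (Polynomial.eval x), ite_mul]

/-- The linear map sending the coefficients `A` to the form `∑ₖ Aₖ wₖ`. -/
noncomputable def linFormMap {r : ℕ} (w : Fin r → ℝ → ℝ) (n : Fin r → ℕ) :
    (∀ k, degreeLT ℝ (n k)) →ₗ[ℝ] (ℝ → ℝ) where
  toFun A := linForm w fun k => A k
  map_add' A B := by
    funext x
    simp [linForm, add_mul, Finset.sum_add_distrib]
  map_smul' c A := by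
    funext x
    simp [linForm, Finset.mul_sum, mul_assoc]

theorem range_linFormMap {r : ℕ} (w : Fin r → ℝ → ℝ) (n : Fin r → ℕ) :
    LinearMap.range (linFormMap w n) = formSpace w n := by
  ext f
  constructor
  · rintro ⟨A, rfl⟩
    exact ⟨fun k => A k, fun k => mem_degreeLT.1 (A k).2, rfl⟩
  · rintro ⟨A, hA, rfl⟩
    exact ⟨fun k => ⟨A k, mem_degreeLT.2 (hA k)⟩, rfl⟩

instance finite_formSpace {r : ℕ} (w : Fin r → ℝ → ℝ) (n : Fin r → ℕ) :
    Module.Finite ℝ (formSpace w n) := by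
  rw [← range_linFormMap]
  have : ∀ k, Module.Finite ℝ (degreeLT ℝ (n k)) := fun k =>
    Module.Finite.equiv (degreeLTEquiv ℝ (n k)).symm
  infer_instance

theorem finrank_formSpace_le {r : ℕ} (w : Fin r → ℝ → ℝ) (n : Fin r → ℕ) :
    Module.finrank ℝ (formSpace w n) ≤ ∑ k, n k := by
  rw [← range_linFormMap]
  have : ∀ k, Module.Finite ℝ (degreeLT ℝ (n k)) := fun k =>
    Module.Finite.equiv (degreeLTEquiv ℝ (n k)).symm
  refine (LinearMap.finrank_range_le _).trans ?_
  rw [Module.finrank_pi_fintype]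
  refine Finset.sum_le_sum fun k _ => ?_
  rw [(degreeLTEquiv ℝ (n k)).finrank_eq]
  simp

/-- The map sending a form to its class in `L²`. -/
noncomputable def formSpaceToL2 {r : ℕ} {w : Fin r → ℝ → ℝ} {n : Fin r → ℕ}
    (hL : ∀ k, ∀ j < n k, MemLp (fun x : ℝ => x ^ j * w k x) 2 volume) :
    formSpace w n →ₗ[ℝ] formSpaceL2 w n where
  toFun f := ⟨(memLp_of_mem_formSpace hL f.2).toLp, f, f.2, MemLp.coeFn_toLp _⟩
  map_add' _ _ := rfl
  map_smul' _ _ := rfl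

theorem formSpaceToL2_surjective {r : ℕ} {w : Fin r → ℝ → ℝ} {n : Fin r → ℕ}
    (hL : ∀ k, ∀ j < n k, MemLp (fun x : ℝ => x ^ j * w k x) 2 volume) :
    Function.Surjective (formSpaceToL2 hL) := by
  rintro ⟨g, f, hf, hgf⟩
  refine ⟨⟨f, hf⟩, Subtype.ext (Lp.ext ?_)⟩
  exact (MemLp.coeFn_toLp (memLp_of_mem_formSpace hL hf)).trans hgf.symm

theorem finrank_formSpace_eq {r N : ℕ} {w : Fin r → ℝ → ℝ} {n : Fin r → ℕ}
    (hL : ∀ k, ∀ j < n k, MemLp (fun x : ℝ => x ^ j * w k x) 2 volume) (hN : ∑ k, n k = N)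
    (hF : Module.finrank ℝ (formSpaceL2 w n) = N) : Module.finrank ℝ (formSpace w n) = N := by
  refine le_antisymm (hN ▸ finrank_formSpace_le w n) ?_
  rw [← hF, ← finrank_top ℝ (formSpaceL2 w n),
    ← LinearMap.range_eq_top.2 (formSpaceToL2_surjective hL)]
  exact LinearMap.finrank_range_le _

/-- Coefficients give at most `N` dimensions of functions, and the classes already fill `N`. Hence a
form vanishing almost everywhere vanishes identically, which lets the pointwise kernel be treated
through `L²` data. -/
theorem formSpaceToL2_injective {r N : ℕ} {w : Fin r → ℝ → ℝ} {n : Fin r → ℕ}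
    (hL : ∀ k, ∀ j < n k, MemLp (fun x : ℝ => x ^ j * w k x) 2 volume) (hN : ∑ k, n k = N)
    (hF : Module.finrank ℝ (formSpaceL2 w n) = N) : Function.Injective (formSpaceToL2 hL) := by
  have := Module.Finite.of_surjective _ (formSpaceToL2_surjective hL)
  exact (LinearMap.injective_iff_surjective_of_finrank_eq_finrank
    ((finrank_formSpace_eq hL hN hF).trans hF.symm)).2 (formSpaceToL2_surjective hL)

/-- The integral pairing between two spaces of square integrable functions. -/
noncomputable def integralPairing (F G : Submodule ℝ (ℝ → ℝ)) (hF : ∀ f ∈ F, MemLp f 2 volume)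
    (hG : ∀ g ∈ G, MemLp g 2 volume) : F →ₗ[ℝ] Module.Dual ℝ G :=
  LinearMap.mk₂ ℝ (fun f g => ∫ x : ℝ, f.1 x * g.1 x)
    (fun f f' g => by
      have h1 := (hF f f.2).integrable_mul (hG g g.2)
      have h2 := (hF f' f'.2).integrable_mul (hG g g.2)
      simpa [add_mul] using integral_add h1 h2)
    (fun c f g => by simp [mul_assoc, integral_const_mul])
    (fun f g g' => by
      have h1 := (hF f f.2).integrable_mul (hG g g.2)
      have h2 := (hF f f.2).integrable_mul (hG g' g'.2)
      simpa [mul_add] using integral_add h1 h2)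
    (fun c f g => by simp [mul_left_comm, integral_const_mul])

theorem span_range_coe_basis {ι V : Type*} [AddCommGroup V] [Module ℝ V] {F : Submodule ℝ V}
    (b : Module.Basis ι ℝ F) : Submodule.span ℝ (Set.range fun i => (b i : V)) = F := by
  have := congrArg (Submodule.map F.subtype) b.span_eq
  rw [Submodule.map_span, Submodule.map_top, Submodule.range_subtype, ← Set.range_comp] at this
  exact this

theorem linearIndependent_coe_basis {ι V : Type*} [AddCommGroup V] [Module ℝ V]
    {F : Submodule ℝ V} (b : Module.Basis ι ℝ F) : LinearIndependent ℝ fun i => (b i : V) :=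
  b.linearIndependent.map' F.subtype F.ker_subtype

/-- Nondegeneracy and equal dimensions make the pairing an isomorphism of `F` with the dual of `G`;
pull back the dual basis of any basis of `G`. -/
theorem exists_isBiorthogonalBases {N : ℕ} {F G : Submodule ℝ (ℝ → ℝ)} [Module.Finite ℝ F]
    [Module.Finite ℝ G] (hF : ∀ f ∈ F, MemLp f 2 volume) (hG : ∀ g ∈ G, MemLp g 2 volume)
    (hdF : Module.finrank ℝ F = N) (hdG : Module.finrank ℝ G = N)
    (hnd : ∀ f ∈ F, (∀ g ∈ G, ∫ x : ℝ, f x * g x = 0) → f = 0) :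
    ∃ φ ψ : Fin N → ℝ → ℝ, IsBiorthogonalBases F G φ ψ := by
  have hinj : Function.Injective (integralPairing F G hF hG) := by
    refine (injective_iff_map_eq_zero _).2 fun f hf => Subtype.ext (hnd f f.2 fun g hg => ?_)
    exact LinearMap.congr_fun hf ⟨g, hg⟩
  let e : F ≃ₗ[ℝ] Module.Dual ℝ G := LinearEquiv.ofInjectiveOfFinrankEq
    (integralPairing F G hF hG) hinj (by rw [Subspace.dual_finrank_eq, hdF, hdG])
  let b : Module.Basis (Fin N) ℝ G := Module.finBasisOfFinrankEq ℝ G hdG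
  let a : Module.Basis (Fin N) ℝ F := b.dualBasis.map e.symm
  refine ⟨fun i => a i, fun i => b i, linearIndependent_coe_basis a, span_range_coe_basis a,
    linearIndependent_coe_basis b, span_range_coe_basis b, fun j k => ?_⟩
  have h1 : e (a j) = b.dualBasis j := by simp [a]
  have h2 := LinearMap.congr_fun h1 (b k)
  rw [b.dualBasis_apply_self] at h2
  refine Eq.trans h2 ?_
  simp [eq_comm]

theorem eq_zero_of_forall_integral_eq_zero {p q N : ℕ} {w₁ : Fin p → ℝ → ℝ}
    {w₂ : Fin q → ℝ → ℝ} {n : Fin p → ℕ} {m : Fin q → ℕ}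
    (hL₁ : ∀ k, ∀ j < n k, MemLp (fun x : ℝ => x ^ j * w₁ k x) 2 volume)
    (hN : ∑ k, n k = N) (hF : Module.finrank ℝ (formSpaceL2 w₁ n) = N)
    (hFG : formSpaceL2 w₁ n ⊓ (formSpaceL2 w₂ m)ᗮ = ⊥) {f : ℝ → ℝ} (hf : f ∈ formSpace w₁ n)
    (h0 : ∀ g ∈ formSpace w₂ m, ∫ x : ℝ, f x * g x = 0) : f = 0 := by
  have hmem : ((formSpaceToL2 hL₁ ⟨f, hf⟩ : formSpaceL2 w₁ n) : Lp ℝ 2 volume) ∈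
      formSpaceL2 w₁ n ⊓ (formSpaceL2 w₂ m)ᗮ := by
    refine ⟨Subtype.property _, fun u hu => ?_⟩
    obtain ⟨g, hg, hug⟩ := hu
    rw [L2.inner_def, ← h0 g hg]
    refine integral_congr_ae ?_
    filter_upwards [hug, MemLp.coeFn_toLp (memLp_of_mem_formSpace hL₁ hf)] with x h1 h2
    change inner ℝ (u x) ((memLp_of_mem_formSpace hL₁ hf).toLp f x) = f x * g x
    rw [h1, h2]
    simp
  rw [hFG, Submodule.mem_bot] at hmem
  have := formSpaceToL2_injective hL₁ hN hF
    (a₁ := ⟨f, hf⟩) (a₂ := 0) (by rw [map_zero]; exact Subtype.ext hmem)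
  exact congrArg Subtype.val this

/-! ### Identification of the kernel -/

theorem IsBiorthogonalBases.integral_sum_mul {N : ℕ} {F G : Submodule ℝ (ℝ → ℝ)}
    {φ ψ : Fin N → ℝ → ℝ} (h : IsBiorthogonalBases F G φ ψ) (hF : ∀ f ∈ F, MemLp f 2 volume)
    (hG : ∀ g ∈ G, MemLp g 2 volume) (c : Fin N → ℂ) (i : Fin N) :
    ∫ y : ℝ, (∑ j, c j * (ψ j y : ℂ)) * (φ i y : ℂ) = c i := by
  have hφ : φ i ∈ F := h.span_left ▸ Submodule.subset_span ⟨i, rfl⟩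
  have hψ : ∀ j, ψ j ∈ G := fun j => h.span_right ▸ Submodule.subset_span ⟨j, rfl⟩
  have h1 : (fun y : ℝ => (∑ j, c j * (ψ j y : ℂ)) * (φ i y : ℂ)) =
      fun y => ∑ j, c j * ((φ i y * ψ j y : ℝ) : ℂ) := by
    funext y
    rw [Finset.sum_mul]
    refine Finset.sum_congr rfl fun j _ => ?_
    push_cast
    ring
  rw [h1, integral_finsetSum]
  · have h2 : ∀ j, ∫ y : ℝ, c j * ((φ i y * ψ j y : ℝ) : ℂ) = c j * (if i = j then 1 else 0) := by
      intro j
      rw [integral_const_mul, integral_complex_ofReal, h.biorthogonal]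
      split_ifs <;> simp
    rw [Finset.sum_congr rfl fun j _ => h2 j]
    simp
  · intro j _
    exact (((hF _ hφ).integrable_mul (hG _ (hψ j))).ofReal).const_mul _

/-- The constants `d` are chosen before `Q`, by expanding each monomial form `x ^ s * w₂ l` in the
`ψ j`. Coordinates then depend linearly on the coefficients of `Q`, hence continuously on any
parameter those depend on continuously. -/
theorem exists_sum_eval_mul_eq {q N : ℕ} {w₂ : Fin q → ℝ → ℝ} {m : Fin q → ℕ}
    {ψ : Fin N → ℝ → ℝ} (hψ : Submodule.span ℝ (Set.range ψ) = formSpace w₂ m) :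
    ∃ d : (l : Fin q) → Fin (m l) → Fin N → ℝ, ∀ Q : Fin q → ℂ[X],
      (∀ l, (Q l).degree < (m l : WithBot ℕ)) → ∀ y : ℝ, ∑ l, (Q l).eval (y : ℂ) * (w₂ l y : ℂ) =
        ∑ j, (∑ l, ∑ s : Fin (m l), (Q l).coeff s * (d l s j : ℂ)) * (ψ j y : ℂ) := by
  have h1 : ∀ (l : Fin q) (s : Fin (m l)), ∃ d : Fin N → ℝ,
      ∑ j, d j • ψ j = fun x : ℝ => x ^ (s : ℕ) * w₂ l x := by
    intro l s
    refine (Submodule.mem_span_range_iff_exists_fun ℝ).1 ?_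
    rw [hψ]
    exact pow_mul_mem_formSpace w₂ l s.2
  choose d hd using h1
  refine ⟨d, fun Q hQ y => ?_⟩
  have h2 : ∀ (l : Fin q) (s : Fin (m l)),
      ∑ j, (d l s j : ℂ) * (ψ j y : ℂ) = (y : ℂ) ^ (s : ℕ) * (w₂ l y : ℂ) := by
    intro l s
    have := congrFun (hd l s) y
    simp only [Finset.sum_apply, Pi.smul_apply, smul_eq_mul] at this
    exact_mod_cast this
  simp only [Finset.sum_mul]
  rw [Finset.sum_comm]
  refine Finset.sum_congr rfl fun l _ => ?_
  rw [Finset.sum_comm, eval_eq_sum,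
    ← (Q l).sum_fin (fun i a => a * (y : ℂ) ^ i) (by simp) (hQ l), Finset.sum_mul]
  refine Finset.sum_congr rfl fun s _ => ?_
  simp_rw [mul_assoc]
  rw [← Finset.mul_sum, h2]

theorem IsRHSolution.kernel_eq {p q N : ℕ} {w₁ : Fin p → ℝ → ℝ} {w₂ : Fin q → ℝ → ℝ}
    {n : Fin p → ℕ} {m : Fin q → ℕ} {Y : ℂ → Matrix (Fin p ⊕ Fin q) (Fin p ⊕ Fin q) ℂ}
    {Yplus Yminus : ℝ → Matrix (Fin p ⊕ Fin q) (Fin p ⊕ Fin q) ℂ}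
    (h : IsRHSolution w₁ w₂ n m Y Yplus Yminus)
    (hL₁ : ∀ k, ∀ j < n k, MemLp (fun x : ℝ => x ^ j * w₁ k x) 2 volume)
    (hL₂ : ∀ l, ∀ j < m l, MemLp (fun x : ℝ => x ^ j * w₂ l x) 2 volume)
    (hnm : ∑ k, n k = ∑ l, m l) {φ ψ : Fin N → ℝ → ℝ}
    (hb : IsBiorthogonalBases (formSpace w₁ n) (formSpace w₂ m) φ ψ) {x y : ℝ} (hxy : x ≠ y) :
    (kernel φ ψ x y : ℂ) = 1 / (2 * Real.pi * Complex.I * ((x : ℂ) - (y : ℂ))) *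
      (rightVec p w₂ y ⬝ᵥ Matrix.mulVec ((Yplus y)⁻¹ * Yplus x) (leftVec q w₁ x)) := by
  choose A hA hAp using h.exists_polynomial_column
  choose B hBd hB hBp using h.exists_polynomial_row hnm
  have hφ : ∀ i, φ i ∈ formSpace w₁ n := fun i => hb.span_left ▸ Submodule.subset_span ⟨i, rfl⟩
  choose P hP hφP using hφ
  obtain ⟨d, hd⟩ := exists_sum_eval_mul_eq hb.span_right
  set Q : Fin p → ℂ → Fin q → ℂ[X] := fun k z l => dividedDifference (fun i => A i k) (B l) z
    with hQ
  have hQd : ∀ k z l, (Q k z l).degree < (m l : WithBot ℕ) := fun k z l =>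
    degree_dividedDifference_lt _ _ z (hBd l)
  set c : Fin p → ℂ → Fin N → ℂ := fun k z j =>
    ∑ l, ∑ s : Fin (m l), (Q k z l).coeff s * (d l s j : ℂ) with hc
  have hsum : ∀ k z (t : ℝ), ∑ l, (Q k z l).eval (t : ℂ) * (w₂ l t : ℂ) =
      ∑ j, c k z j * (ψ j t : ℂ) := fun k z t => hd (Q k z) (hQd k z) t
  have hcont : ∀ k j, Continuous fun z => c k z j := fun k j =>
    continuous_finsetSum _ fun l _ => continuous_finsetSum _ fun s _ =>
      (continuous_coeff_dividedDifference _ _ _).mul continuous_const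
  -- Integrating against `φ j` gives the coordinate `c k z j` by biorthogonality, and `2πi` times
  -- the `k`-th coefficient polynomial of `φ j` by the reproducing property.
  have hupper : ∀ k j (z : ℂ), 0 < z.im →
      c k z j = 2 * Real.pi * Complex.I * ((P j k).map (algebraMap ℝ ℂ)).eval z := by
    intro k j z hz
    rw [← hb.integral_sum_mul (fun _ => memLp_of_mem_formSpace hL₁)
      (fun _ => memLp_of_mem_formSpace hL₂) (c k z) j,
      ← h.integral_dividedDifference_mul_linForm hnm hA hB hBp (hP j) k hz]
    simp_rw [← hsum, ← hφP, hQ]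
  -- Cauchy's formula is unavailable on the axis, but both sides are continuous in `z`, so the
  -- identity persists at the real point `x`.
  have hreal : ∀ k j, c k x j = 2 * Real.pi * Complex.I * ((P j k).eval x : ℝ) := by
    intro k j
    have hev : ((P j k).map (algebraMap ℝ ℂ)).eval (x : ℂ) = ((P j k).eval x : ℝ) :=
      (eval_map _ _).trans (eval₂_at_apply (algebraMap ℝ ℂ) x)
    have := nhdsWithin_upper_neBot x
    rw [← hev]
    have hpc : Continuous fun z : ℂ =>
        2 * Real.pi * Complex.I * ((P j k).map (algebraMap ℝ ℂ)).eval z := by fun_prop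
    refine tendsto_nhds_unique
      (((hcont k j).tendsto (x : ℂ)).mono_left (nhdsWithin_le_nhds (s := {z : ℂ | 0 < z.im})))
      (((hpc.tendsto (x : ℂ)).mono_left nhdsWithin_le_nhds).congr' ?_)
    filter_upwards [self_mem_nhdsWithin] with z hz using (hupper k j z hz).symm
  have hdet := (h.det_eq_one hnm).2
  have hne : (x : ℂ) - y ≠ 0 := sub_ne_zero.2 (by exact_mod_cast hxy)
  -- Only the lower left block survives between the two vectors; its polynomial entries factor
  -- through `x - y`.
  have hentry : ∀ l k, ((Yplus y)⁻¹ * Yplus x) (Sum.inr l) (Sum.inl k) =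
      (x - y) * (Q k x l).eval (y : ℂ) := by
    intro l k
    rw [hQ, sub_mul_eval_dividedDifference, Matrix.inv_def, hdet, Ring.inverse_one, one_smul,
      Matrix.mul_apply]
    · simp_rw [hBp, hAp, mul_comm]
    · simp_rw [← hBp, ← hAp, mul_comm (Yplus x _ _)]
      rw [← Matrix.mul_apply, Matrix.adjugate_mul, hdet]
      simp
  have hdot : rightVec p w₂ y ⬝ᵥ Matrix.mulVec ((Yplus y)⁻¹ * Yplus x) (leftVec q w₁ x) =
      (x - y) * ∑ k, (w₁ k x : ℂ) * ∑ l, (Q k x l).eval (y : ℂ) * (w₂ l y : ℂ) := by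
    simp only [dotProduct, Matrix.mulVec, Fintype.sum_sum_type, rightVec, leftVec, Sum.elim_inl,
      Sum.elim_inr, zero_mul, mul_zero, Finset.sum_const_zero, zero_add, add_zero, hentry,
      Finset.mul_sum]
    rw [Finset.sum_comm]
    exact Finset.sum_congr rfl fun k _ => Finset.sum_congr rfl fun l _ => by ring
  have hker : ∑ k, (w₁ k x : ℂ) * ∑ j, c k x j * (ψ j y : ℂ) =
      2 * Real.pi * Complex.I * (kernel φ ψ x y : ℂ) := by
    simp only [hreal, kernel, hφP, linForm]
    push_cast
    simp only [Finset.mul_sum, Finset.sum_mul]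
    rw [Finset.sum_comm]
    exact Finset.sum_congr rfl fun k _ => Finset.sum_congr rfl fun l _ => by ring
  rw [hdot]
  simp_rw [hsum]
  rw [hker]
  have hpi : (Real.pi : ℂ) ≠ 0 := by exact_mod_cast Real.pi_ne_zero
  field_simp

end MixedMOP

theorem theorem4p3 {p q : ℕ}
    (w₁ : Fin p → ℝ → ℝ) (w₂ : Fin q → ℝ → ℝ) (n : Fin p → ℕ) (m : Fin q → ℕ)
    (hw₁ : ∀ k, MixedMOP.IsWeight (w₁ k)) (hw₂ : ∀ l, MixedMOP.IsWeight (w₂ l))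
    (hL₁ : ∀ k, ∀ j < n k, MemLp (fun x : ℝ => x ^ j * w₁ k x) 2 volume)
    (hL₂ : ∀ l, ∀ j < m l, MemLp (fun x : ℝ => x ^ j * w₂ l x) 2 volume)
    (hnm : ∑ k, n k = ∑ l, m l)
    (hF : Module.finrank ℝ (MixedMOP.formSpaceL2 w₁ n) = ∑ k, n k)
    (hG : Module.finrank ℝ (MixedMOP.formSpaceL2 w₂ m) = ∑ k, n k)
    (hFG : MixedMOP.formSpaceL2 w₁ n ⊓ (MixedMOP.formSpaceL2 w₂ m)ᗮ = ⊥) :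
    (∃ φ ψ : Fin (∑ k, n k) → ℝ → ℝ,
      MixedMOP.IsBiorthogonalBases (MixedMOP.formSpace w₁ n) (MixedMOP.formSpace w₂ m) φ ψ) ∧
    ∀ φ ψ : Fin (∑ k, n k) → ℝ → ℝ,
      MixedMOP.IsBiorthogonalBases (MixedMOP.formSpace w₁ n) (MixedMOP.formSpace w₂ m) φ ψ →
      ∀ (Y : ℂ → Matrix (Fin p ⊕ Fin q) (Fin p ⊕ Fin q) ℂ)
        (Yplus Yminus : ℝ → Matrix (Fin p ⊕ Fin q) (Fin p ⊕ Fin q) ℂ),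
        MixedMOP.IsRHSolution w₁ w₂ n m Y Yplus Yminus →
        (∀ y : ℝ, IsUnit (Yplus y)) ∧
        ∀ x y : ℝ, x ≠ y →
          ((MixedMOP.kernel φ ψ x y : ℝ) : ℂ) =
            1 / (2 * Real.pi * Complex.I * ((x : ℂ) - (y : ℂ))) *
              (MixedMOP.rightVec p w₂ y ⬝ᵥ
                Matrix.mulVec ((Yplus y)⁻¹ * Yplus x) (MixedMOP.leftVec q w₁ x)) := by
  refine ⟨MixedMOP.exists_isBiorthogonalBases
    (fun _ => MixedMOP.memLp_of_mem_formSpace hL₁) (fun _ => MixedMOP.memLp_of_mem_formSpace hL₂)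
    (MixedMOP.finrank_formSpace_eq hL₁ rfl hF) (MixedMOP.finrank_formSpace_eq hL₂ hnm.symm hG)
    fun _ hf => MixedMOP.eq_zero_of_forall_integral_eq_zero hL₁ rfl hF hFG hf, ?_⟩
  intro φ ψ hb Y Yplus Yminus h
  refine ⟨fun y => ?_, fun x y hxy => h.kernel_eq hL₁ hL₂ hnm hb hxy⟩
  rw [Matrix.isUnit_iff_isUnit_det, (h.det_eq_one hnm).2 y]
  exact isUnit_one
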